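/- Conventions. A finite-horizon MDP with state set $\mathcal S$, action set $\mathcal A$ (every action is available in every state) and horizon $H$ has an initial state $s_1$, transition laws $p_h(\cdot\mid s,a)$ and reward laws $\nu_h(s,a)$ on $\mathbb R$ with means $r_h(s,a)$, $h=1,\dots,H$. A (deterministic) policy is $\pi=(\pi_h)_{h\le H}$ with $\pi_h:\mathcal S\to\mathcal A$; $V_1^\pi(s_1)$ is its expected total reward in one episode and $V_1^\star(s_1)=\max_\pi V_1^\pi(s_1)$. In episode $t=1,2,\dots$ an algorithm plays a policy $\pi^t$ that depends on the previous episodes (and possibly on an independent internal random seed), and observes the states, actions and rewards of that episode. Let $\mathfrak M$ be the class of MDPs with $S$ states, $A$ actions, horizon $H$, deterministic transitions and Gaussian rewards of variance $1$ (with arbitrary means). An identification algorithm also has a stopping time $\tau$ and returns a policy $\widehat\pi$ when it stops; it is $(\varepsilon,\delta)$-PAC if $\mathbb P_{\mathcal M}\big(\tau<\infty,\ V_1^{\widehat\pi}(s_1)\ge V_1^\star(s_1)-\varepsilon\big)\ge 1-\delta$ for every $\mathcal M\in\mathfrak M$. UCBVI: after $t$ episodes let $n_h^t(s,a)$ be the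 number of visits of $(s,a)$ at stage $h$, let $\widehat r_h^t,\widehat p_h^t$ be the empirical mean rewards and transition frequencies ($0$ without visits), put $\overline Q_{H+1}^t=0$ and $$\overline Q_h^t(s,a)=\widehat r_h^t(s,a)+b_h^t(s,a)+\sum_{s'}\widehat p_h^t(s'\mid s,a)\max_{a'}\overline Q_{h+1}^t(s',a'),$$ and play in episode $t+1$ a policy with $\pi_h^{t+1}(s)\in\arg\max_a\overline Q_h^t(s,a)$. Here the bonus at the last stage is $b_H^t(s,a)=\sqrt{2\log(2SAHt^2)/n_H^t(s,a)}$ ($+\infty$ if $n_H^t(s,a)=0$); at stages $h<H$ it may be any function, with values in $[0,+\infty]$, of $h$, $t$ and $n_h^t(s,a)$. Theorem. Let $S\ge4$, $A\ge2$ and $H\ge\lceil\log_2 S\rceil+1$ be integers. For every $\varepsilon>0$ there is an MDP $\mathcal M\in\mathfrak M$, some policy of which satisfies $V_1^\star(s_1)-V_1^\pi(s_1)=\varepsilon$, such that for every $\delta\in(0,1)$ the following hold. (i) For UCBVI, with any choice of the bonuses at stages $h<H$ as above and any tie-breaking that depends only on the set of maximizing actions, $$T_\varepsilon:=\inf\Big\{T\in\mathbb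 N_{\ge1}:\ \frac1T\sum_{t=1}^T\mathbb E_{\mathcal M}\big[V_1^\star(s_1)-V_1^{\pi^t}(s_1)\big]\le\varepsilon\delta\Big\}\ \le\ \frac{2}{\varepsilon^2\delta}\Big(36\log(2SAH)+16\log\frac{17}{\varepsilon^2\delta}+9\varepsilon^2\Big)+1 .$$ (ii) Every $(\varepsilon,\delta)$-PAC identification algorithm satisfies $$\mathbb E_{\mathcal M}[\tau]\ \ge\ \frac{SA\log\big(1/(4\delta)\big)}{16\,\varepsilon^2}.$$ -/

import Mathlib

open MeasureTheory ProbabilityTheory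
open scoped ENNReal

/-- A deterministic policy `π = (π_h)_h`; stages are indexed from `0` to `H - 1`. -/
abbrev Policy (S A : Type) (H : ℕ) : Type := Fin H → S → A

/-- The record `(s_h, a_h, r_h)_h` of one episode. -/
abbrev Episode (S A : Type) (H : ℕ) : Type := Fin H → S × A × ℝ

/-- What has been observed after `t` episodes. -/
abbrev History (S A : Type) (H t : ℕ) : Type := Fin t → Episode S A H

/-- A finite-horizon, time-inhomogeneous MDP with integrable random rewards. -/
structure MDP (S A : Type) (H : ℕ) where
  /-- the initial state -/
  init : S
  /-- `trans h s a` is the law of the next state -/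
  trans : Fin H → S → A → PMF S
  /-- `reward h s a` is the law of the reward -/
  reward : Fin H → S → A → Measure ℝ
  reward_prob : ∀ h s a, IsProbabilityMeasure (reward h s a)
  reward_integrable : ∀ h s a, Integrable (fun x : ℝ => x) (reward h s a)

attribute [instance] MDP.reward_prob

namespace MDP

variable {S A : Type} {H : ℕ}

/-- Transitions are deterministic. -/
def IsDeterministic (M : MDP S A H) : Prop :=
  ∀ h s a, ∃ s', M.trans h s a = PMF.pure s'

/-- All rewards are Gaussian with variance one (and arbitrary real means). -/
def HasUnitGaussianRewards (M : MDP S A H) : Prop :=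
  ∀ h s a, ∃ m : ℝ, M.reward h s a = gaussianReal m 1

/-- The class of deterministic MDPs with unit-variance Gaussian rewards. -/
def gaussianDeterministic (S A : Type) (H : ℕ) : Set (MDP S A H) :=
  {M | M.IsDeterministic ∧ M.HasUnitGaussianRewards}

/-- The mean reward `r_h(s, a)`. -/
noncomputable def meanReward (M : MDP S A H) (h : Fin H) (s : S) (a : A) : ℝ :=
  ∫ x, x ∂(M.reward h s a)

/-- The value `V_h^π(s)`, by the Bellman equations, with value `0` once `h` reaches `H`. -/
noncomputable def valueFrom [Fintype S] (M : MDP S A H) (π : Policy S A H) (h : ℕ) (s : S) : ℝ :=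
  if hh : h < H then
    M.meanReward ⟨h, hh⟩ s (π ⟨h, hh⟩ s) +
      ∑ s', (M.trans ⟨h, hh⟩ s (π ⟨h, hh⟩ s) s').toReal * valueFrom M π (h + 1) s'
  else 0
termination_by H - h

/-- The value of `π` from the initial state and the first stage. -/
noncomputable def value [Fintype S] (M : MDP S A H) (π : Policy S A H) : ℝ :=
  M.valueFrom π 0 M.init

/-- The optimal value: the maximum of `value` over the finitely many deterministic policies. -/
noncomputable def optValue [Fintype S] (M : MDP S A H) : ℝ :=
  ⨆ π : Policy S A H, M.value π

end MDP

/-! ### Interaction of an algorithm with an MDP -/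

/-- A sampling rule: the policy of the next episode is a function of an internal random seed
`u : U` and of the `t` episodes observed so far. -/
abbrev SamplingRule (U S A : Type*) (H : ℕ) : Type _ :=
  (t : ℕ) → U → (Fin t → Fin H → S × A × ℝ) → (Fin H → S → A)

/-- The environment's randomness: the entry at `(t, h, s, a)` is the pair (reward, next state)
that results from taking action `a` in state `s` at stage `h` of episode `t`. -/
abbrev Noise (S A : Type) (H : ℕ) : Type := ℕ × Fin H × S × A → ℝ × S

section Interaction

variable {U : Type*} {S A : Type} {H : ℕ}

/-- The law of seed and environment. All entries of the table are independent of each other and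
of the seed, and the entry at `(t, h, s, a)` has reward of law `reward h s a` and next state of
law `trans h s a`. An interaction reads every entry at most once, so that given the past the
observed reward and next state have exactly these laws. -/
noncomputable def MDP.law [MeasurableSpace U] [MeasurableSpace S] (M : MDP S A H)
    (ν : Measure U) : Measure (U × Noise S A H) :=
  ν.prod (Measure.infinitePi fun i : ℕ × Fin H × S × A =>
    (M.reward i.2.1 i.2.2.1 i.2.2.2).prod (M.trans i.2.1 i.2.2.1 i.2.2.2).toMeasure)

/-- The state at stage `h` when `π` is played from state `s₁`
against the episode's randomness `w`. -/
def stateAt (s₁ : S) (π : Policy S A H) (w : Fin H → S → A → ℝ × S) : ℕ → S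
  | 0 => s₁
  | h + 1 =>
    if hh : h < H then
      (w ⟨h, hh⟩ (stateAt s₁ π w h) (π ⟨h, hh⟩ (stateAt s₁ π w h))).2
    else stateAt s₁ π w h

/-- The episode generated by `π` from state `s₁` against the episode's randomness `w`. -/
def rollout (s₁ : S) (π : Policy S A H) (w : Fin H → S → A → ℝ × S) : Episode S A H :=
  fun h =>
    (stateAt s₁ π w h, π h (stateAt s₁ π w h), (w h (stateAt s₁ π w h) (π h (stateAt s₁ π w h))).1)

/-- The episode number `t` (counted from `0`) of the interaction of `alg` with `M`. -/
def MDP.episode (M : MDP S A H) (alg : SamplingRule U S A H) (ω : U × Noise S A H) (t : ℕ) :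
    Episode S A H :=
  rollout M.init (alg t ω.1 (fun i : Fin t => MDP.episode M alg ω i))
    (fun h s a => ω.2 (t, h, s, a))
termination_by t
decreasing_by exact i.2

/-- The first `t` episodes of the interaction. -/
def MDP.history (M : MDP S A H) (alg : SamplingRule U S A H) (t : ℕ) (ω : U × Noise S A H) :
    History S A H t :=
  fun i => M.episode alg ω i

/-- The policy played in episode number `t` (counted from `0`). -/
def MDP.policyAt (M : MDP S A H) (alg : SamplingRule U S A H) (t : ℕ) (ω : U × Noise S A H) :
    Policy S A H :=
  alg t ω.1 (M.history alg t ω)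

/-- The expected average regret of the first `T` episodes. -/
noncomputable def MDP.avgRegret [MeasurableSpace U] [MeasurableSpace S] [Fintype S]
    (M : MDP S A H) (ν : Measure U) (alg : SamplingRule U S A H) (T : ℕ) : ℝ :=
  1 / (T : ℝ) *
    ∑ t ∈ Finset.range T, ∫ ω, (M.optValue - M.value (M.policyAt alg t ω)) ∂(M.law ν)

/-- The first `T ≥ 1` at which the expected average regret is at most `c` (`⊤` if none). -/
noncomputable def MDP.regretTime [MeasurableSpace U] [MeasurableSpace S] [Fintype S]
    (M : MDP S A H) (ν : Measure U) (alg : SamplingRule U S A H) (c : ℝ) : ℕ∞ :=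
  ⨅ (T : ℕ) (_ : 1 ≤ T ∧ M.avgRegret ν alg T ≤ c), (T : ℕ∞)

/-! ### PAC identification -/

/-- An identification algorithm: sampling rule, stopping rule and recommendation rule, all of
them based on the internal seed and on the episodes observed so far. -/
structure PACAlgorithm (U : Type*) [MeasurableSpace U] (S A : Type) [MeasurableSpace S]
    [MeasurableSpace A] (H : ℕ) where
  /-- the law of the internal random seed -/
  seedLaw : Measure U
  seed_prob : IsProbabilityMeasure seedLaw
  /-- the sampling rule -/
  sample : SamplingRule U S A H
  measurable_sample : ∀ t, Measurable fun x : U × History S A H t => sample t x.1 x.2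
  /-- the algorithm stops after `t` episodes if seed and history lie in `stopSet t` -/
  stopSet : (t : ℕ) → Set (U × History S A H t)
  measurable_stopSet : ∀ t, MeasurableSet (stopSet t)
  /-- the policy returned if the algorithm stops after `t` episodes -/
  recommend : (t : ℕ) → U × History S A H t → Policy S A H
  measurable_recommend : ∀ t, Measurable (recommend t)

namespace PACAlgorithm

variable [MeasurableSpace U] [MeasurableSpace S] [MeasurableSpace A]

/-- The stopping time `τ`, that is, the number of episodes that are played (`⊤` if the algorithm
never stops). -/
noncomputable def tau (alg : PACAlgorithm U S A H) (M : MDP S A H) (ω : U × Noise S A H) : ℕ∞ :=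
  ⨅ (t : ℕ) (_ : (ω.1, M.history alg.sample t ω) ∈ alg.stopSet t), (t : ℕ∞)

/-- The expected number of episodes `E_M[τ]`. -/
noncomputable def expectedTau (alg : PACAlgorithm U S A H) (M : MDP S A H) : ℝ≥0∞ :=
  ∫⁻ ω, (alg.tau M ω : ℝ≥0∞) ∂(M.law alg.seedLaw)

/-- The algorithm stops and returns an `ε`-optimal policy. -/
def success [Fintype S] (alg : PACAlgorithm U S A H) (M : MDP S A H) (ε : ℝ) :
    Set (U × Noise S A H) :=
  {ω | ∃ t : ℕ, alg.tau M ω = t ∧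
    M.optValue - ε ≤ M.value (alg.recommend t (ω.1, M.history alg.sample t ω))}

/-- `(ε, δ)`-PAC over the class `𝓜` of MDPs. -/
def IsPAC [Fintype S] (alg : PACAlgorithm U S A H) (𝓜 : Set (MDP S A H)) (ε δ : ℝ) : Prop :=
  ∀ M ∈ 𝓜, ENNReal.ofReal (1 - δ) ≤ (M.law alg.seedLaw) (alg.success M ε)

end PACAlgorithm

end Interaction

/-! ### The optimistic regret minimizer -/

section UCBVI

variable {S A : Type} {H : ℕ} [DecidableEq S] [DecidableEq A]

/-- `n_h^t(s, a)`: the number of observed visits of `(s, a)` at stage `h`. -/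
def visits {t : ℕ} (e : History S A H t) (h : Fin H) (s : S) (a : A) : ℕ :=
  (Finset.univ.filter fun i : Fin t => (e i h).1 = s ∧ (e i h).2.1 = a).card

/-- The empirical mean reward of `(s, a)` at stage `h` (`0` if there are no visits). -/
noncomputable def empReward {t : ℕ} (e : History S A H t) (h : Fin H) (s : S) (a : A) : ℝ :=
  (∑ i : Fin t, if (e i h).1 = s ∧ (e i h).2.1 = a then (e i h).2.2 else 0) / visits e h s a

/-- The empirical probability of the transition from `(s, a)` at stage `h` to `s'`
(`0` if there are no visits, or if `h` is the last stage, where the next state plays no role). -/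
noncomputable def empTrans {t : ℕ} (e : History S A H t) (h : Fin H) (s : S) (a : A) (s' : S) :
    ℝ :=
  ((Finset.univ.filter fun i : Fin t => ((e i h).1 = s ∧ (e i h).2.1 = a) ∧
    ∃ hh : (h : ℕ) + 1 < H, (e i ⟨h + 1, hh⟩).1 = s').card : ℝ) / visits e h s a

/-- The optimistic action values, for bonuses `b h t n` that depend on the stage `h`, the number
`t` of observed episodes and the number `n` of visits:
`Q_h(s, a) = r̂_h(s, a) + b h t n + ∑ s', p̂_h(s' | s, a) * max_{a'} Q_{h+1}(s', a')`. -/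
noncomputable def ucbQ [Fintype S] (b : Fin H → ℕ → ℕ → ℝ≥0∞) {t : ℕ} (e : History S A H t)
    (h : ℕ) (s : S) (a : A) : EReal :=
  if hh : h < H then
    (empReward e ⟨h, hh⟩ s a : EReal) + (b ⟨h, hh⟩ t (visits e ⟨h, hh⟩ s a) : EReal) +
      ∑ s', (empTrans e ⟨h, hh⟩ s a s' : EReal) * ⨆ a', ucbQ b e (h + 1) s' a'
  else 0
termination_by H - h

open Classical in
/-- The set of actions that are greedy for the optimistic action values. -/
noncomputable def ucbGreedy [Fintype S] [Fintype A] (b : Fin H → ℕ → ℕ → ℝ≥0∞) {t : ℕ}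
    (e : History S A H t) (h : Fin H) (s : S) : Finset A :=
  Finset.univ.filter fun a => ∀ a', ucbQ b e h s a' ≤ ucbQ b e h s a

/-- UCBVI with bonuses `b`: play greedily for the optimistic action values, where `pick` breaks
the ties. The algorithm is not randomized. -/
noncomputable def ucbvi [Fintype S] [Fintype A] (b : Fin H → ℕ → ℕ → ℝ≥0∞)
    (pick : Finset A → A) : SamplingRule Unit S A H :=
  fun _ _ e h s => pick (ucbGreedy b e h s)

/-- At the last stage the bonus is the Hoeffding bonus `√(2 log(2 S A H t²) / n)` for rewards that
are sub-Gaussian with variance proxy one, infinite for `n = 0`. At the earlier stages the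
bonus is unrestricted. -/
def HasHoeffdingLastBonus (S A H : ℕ) (b : Fin H → ℕ → ℕ → ℝ≥0∞) : Prop :=
  ∀ h : Fin H, (h : ℕ) + 1 = H → ∀ t n : ℕ,
    b h t n = if n = 0 then ⊤
      else ENNReal.ofReal (Real.sqrt (2 * Real.log (2 * S * A * H * (t : ℝ) ^ 2) / n))

end UCBVI

/-! The instance is a binary tree in which the actions spell the digits of the state, so that every
state-action pair of the last stage (a leaf) is reached by some policy (`leafOf_tree_surjective`).
All mean rewards vanish, except that one leaf `c₀` pays `-ε`. Regret is therefore `ε` times the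
number of visits of `c₀`, and all other leaves are optimal.

Upper bound. Playing `c₀ = (s, a)` means that `a` has the largest index at `s`, although another
action `a'` of the same state has a mean larger by `ε`. Whatever brought the path to `s`, in
particular whatever the earlier bonuses are, this comparison is that of a two-armed bandit: with `q
= 2SAH` it allows an expected number of order `log(qT²)/ε²` of visits (`mem_devEvent_of_pull`,
`lintegral_sum_pull_le`). Dividing by `T` and solving for `T` (`exists_horizon`) gives a bound in
which `S` and `A` occur only inside a logarithm.

Lower bound. In this MDP every policy is `ε`-optimal, but the algorithm cannot know this. Raising a
leaf `c ≠ c₀` from `0` to `2ε` makes `c` the only `ε`-optimal leaf, so there the algorithm stops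
without recommending `c` with probability at most `δ`. In the original MDP at most one leaf is
recommended, so for most `c` this same event is likely. Telling the two apart costs about
`log(1/δ)/(2ε²)` visits of `c`, and an episode visits only one leaf, so these costs add up over the
`SA - 1` leaves (`PACAlgorithm.expectedTau_oneBadLeaf_ge`).

Both halves use one change of measure. Given seed and past, an episode is a fixed path with
independent Gaussian rewards (`MDP.lintegral_episode_ofDet`). Hence the product of the likelihood
ratios of the visits to `c` that occur while a predictable gate is open has expectation one
(`lintegral_gatedTilt`). With the gate "still running" this leads to Wald's identity and, through
`integral_log_likelihood_le`, to `le_integral_gatedVisit`. With the gate "fewer than `n` visits"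
Markov's inequality gives the sub-Gaussian tail bound `law_devEvent_le` for adaptively collected
rewards. -/

/-! ### Paths and values under deterministic transitions -/

section Deterministic

variable {S A : Type} {H : ℕ}

/-- The state at stage `h` when `π` is played and all transitions follow `next`. -/
def detState (s₁ : S) (next : Fin H → S → A → S) (π : Policy S A H) : ℕ → S :=
  stateAt s₁ π fun h s a => (0, next h s a)

/-- The action at stage `h` when `π` is played and all transitions follow `next`. -/
def detAction (s₁ : S) (next : Fin H → S → A → S) (π : Policy S A H) (h : Fin H) : A :=
  π h (detState s₁ next π h)

/-- The episode of `π` with transitions `next` and observed rewards `r`. -/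
def detEpisode (s₁ : S) (next : Fin H → S → A → S) (π : Policy S A H) (r : Fin H → ℝ) :
    Episode S A H :=
  fun h => (detState s₁ next π h, detAction s₁ next π h, r h)

theorem stateAt_eq_detState (s₁ : S) {next : Fin H → S → A → S} (π : Policy S A H)
    {w : Fin H → S → A → ℝ × S} (hw : ∀ h s a, (w h s a).2 = next h s a) (h : ℕ) :
    stateAt s₁ π w h = detState s₁ next π h := by
  induction h with
  | zero => rfl
  | succ h ih =>
    unfold detState at ih ⊢
    by_cases hh : h < H
    · simp [stateAt, hh, hw, ih]
    · simp [stateAt, hh, ih]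

theorem rollout_eq_detEpisode (s₁ : S) {next : Fin H → S → A → S} (π : Policy S A H)
    {w : Fin H → S → A → ℝ × S} (hw : ∀ h s a, (w h s a).2 = next h s a) :
    rollout s₁ π w = detEpisode s₁ next π
      fun h => (w h (detState s₁ next π h) (detAction s₁ next π h)).1 := by
  funext h
  simp [rollout, detEpisode, detAction, stateAt_eq_detState s₁ π hw]

theorem detState_succ (s₁ : S) (next : Fin H → S → A → S) (π : Policy S A H) (h : Fin H) :
    detState s₁ next π (h + 1) = next h (detState s₁ next π h) (detAction s₁ next π h) := by
  simp [detState, detAction, stateAt]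

/-- The MDP with transitions `next` and unit-variance Gaussian rewards with means `m`. -/
noncomputable def MDP.ofDet (s₁ : S) (next : Fin H → S → A → S) (m : Fin H → S → A → ℝ) :
    MDP S A H where
  init := s₁
  trans h s a := PMF.pure (next h s a)
  reward h s a := gaussianReal (m h s a) 1
  reward_prob _ _ _ := inferInstance
  reward_integrable _ _ _ := (memLp_id_gaussianReal 1).integrable le_rfl

theorem MDP.valueFrom_ofDet [Fintype S] (s₁ : S) (next : Fin H → S → A → S)
    (m : Fin H → S → A → ℝ) (π : Policy S A H) (h : ℕ) :
    (MDP.ofDet s₁ next m).valueFrom π h (detState s₁ next π h) =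
      ∑ k : Fin H, if h ≤ k then m k (detState s₁ next π k) (detAction s₁ next π k) else 0 := by
  classical
  by_cases hh : h < H
  · have ih := MDP.valueFrom_ofDet s₁ next m π (h + 1)
    have hs := detState_succ s₁ next π ⟨h, hh⟩
    simp only at hs
    rw [hs] at ih
    rw [MDP.valueFrom, dif_pos hh]
    have key : ∀ k : Fin H,
        (if h ≤ k then m k (detState s₁ next π k) (detAction s₁ next π k) else 0) =
        (if k = ⟨h, hh⟩ then m k (detState s₁ next π k) (detAction s₁ next π k) else 0) +
        (if h + 1 ≤ k then m k (detState s₁ next π k) (detAction s₁ next π k) else 0) := by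
      intro k
      by_cases hk : (k : ℕ) = h
      · have : k = ⟨h, hh⟩ := Fin.ext hk
        simp [this]
      · have hk' : k ≠ ⟨h, hh⟩ := fun e => hk (by rw [e])
        have : h ≤ k ↔ h + 1 ≤ k := by omega
        simp [hk', this]
    simp_rw [key, Finset.sum_add_distrib]
    rw [← ih]
    simp [MDP.meanReward, MDP.ofDet, detAction, PMF.pure_apply]
    rw [Finset.sum_eq_single (next ⟨h, hh⟩ (detState s₁ next π h)
      (π ⟨h, hh⟩ (detState s₁ next π h)))]
    · simp
    · intro b _ hb
      simp [hb]
    · simp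
  · rw [MDP.valueFrom, dif_neg hh]
    symm
    apply Finset.sum_eq_zero
    intro k _
    rw [if_neg]
    omega
termination_by H - h

theorem MDP.value_ofDet [Fintype S] (s₁ : S) (next : Fin H → S → A → S)
    (m : Fin H → S → A → ℝ) (π : Policy S A H) :
    (MDP.ofDet s₁ next m).value π =
      ∑ k : Fin H, m k (detState s₁ next π k) (detAction s₁ next π k) := by
  refine (MDP.valueFrom_ofDet s₁ next m π 0).trans ?_
  simp

end Deterministic

/-! ### Measurability of the interaction -/

section Measurability

variable {U : Type*} {S A : Type} {H : ℕ} [MeasurableSpace U]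
  [MeasurableSpace S] [Finite S] [MeasurableSingletonClass S]

theorem measurable_stateAt (s₁ : S) (π : Policy S A H) (h : ℕ) :
    Measurable fun w : Fin H → S → A → ℝ × S => stateAt s₁ π w h := by
  induction h with
  | zero => exact measurable_const
  | succ h ih =>
    by_cases hh : h < H
    · simp only [stateAt, hh, dite_true]
      have : Measurable fun p : S × (Fin H → S → A → ℝ × S) =>
          (p.2 ⟨h, hh⟩ p.1 (π ⟨h, hh⟩ p.1)).2 :=
        measurable_from_prod_countable_right fun s => by
          have : Measurable fun w : Fin H → S → A → ℝ × S => w ⟨h, hh⟩ s (π ⟨h, hh⟩ s) := by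
            fun_prop
          exact this.snd
      exact this.comp (ih.prodMk measurable_id)
    · simpa only [stateAt, hh, dite_false] using ih

theorem measurable_rollout_right [MeasurableSpace A] (s₁ : S) (π : Policy S A H) :
    Measurable fun w : Fin H → S → A → ℝ × S => rollout s₁ π w := by
  refine measurable_pi_lambda _ fun h => ?_
  have h1 := measurable_stateAt s₁ π h
  have h2 : Measurable fun s : S => π h s := measurable_of_countable _
  have : Measurable fun p : S × (Fin H → S → A → ℝ × S) => (p.2 h p.1 (π h p.1)).1 :=
    measurable_from_prod_countable_right fun s => by
      have : Measurable fun w : Fin H → S → A → ℝ × S => w h s (π h s) := by fun_prop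
      exact this.fst
  exact h1.prodMk ((h2.comp h1).prodMk (this.comp (h1.prodMk measurable_id)))

theorem measurable_rollout [MeasurableSpace A] [Finite A] [MeasurableSingletonClass A] (s₁ : S) :
    Measurable fun p : Policy S A H × (Fin H → S → A → ℝ × S) => rollout s₁ p.1 p.2 :=
  measurable_from_prod_countable_right fun π => measurable_rollout_right s₁ π

variable [MeasurableSpace A] [Finite A] [MeasurableSingletonClass A]

/-- A sampling rule all of whose decisions are measurable. -/
def SamplingRule.IsMeasurable (alg : SamplingRule U S A H) : Prop :=
  ∀ t, Measurable fun x : U × History S A H t => alg t x.1 x.2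

theorem MDP.measurable_episode (M : MDP S A H) {alg : SamplingRule U S A H}
    (halg : alg.IsMeasurable) (t : ℕ) : Measurable fun ω => M.episode alg ω t := by
  have hh : Measurable fun ω => M.history alg t ω :=
    measurable_pi_lambda _ fun i => MDP.measurable_episode M halg i
  have hp : Measurable fun ω : U × Noise S A H => alg t ω.1 (M.history alg t ω) :=
    (halg t).comp (measurable_fst.prodMk hh)
  have hw : Measurable fun ω : U × Noise S A H => fun (h : Fin H) s a => ω.2 (t, h, s, a) := by
    fun_prop
  have := (measurable_rollout M.init).comp (hp.prodMk hw)
  convert this using 2 with ω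
  rw [MDP.episode]
  rfl
termination_by t
decreasing_by exact i.2

theorem MDP.measurable_history (M : MDP S A H) {alg : SamplingRule U S A H}
    (halg : alg.IsMeasurable) (t : ℕ) : Measurable (M.history alg t) :=
  measurable_pi_lambda _ fun i => M.measurable_episode halg i

theorem MDP.measurable_policyAt (M : MDP S A H) {alg : SamplingRule U S A H}
    (halg : alg.IsMeasurable) (t : ℕ) : Measurable (M.policyAt alg t) :=
  (halg t).comp (measurable_fst.prodMk (M.measurable_history halg t))

end Measurability

/-! ### The law of one episode given the past -/

section Independence

/-- In a product over `ℕ × J`, the slice at time `t` is independent of what happened before. -/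
theorem lintegral_infinitePi_slice {J E 𝒳 : Type*} [Finite J] [MeasurableSpace E]
    [MeasurableSpace 𝒳] (μ : J → Measure E) [∀ j, IsProbabilityMeasure (μ j)] (t : ℕ)
    {X : (ℕ × J → E) → 𝒳} (hX : Measurable X)
    (hX' : ∀ z z' : ℕ × J → E, (∀ i, i.1 < t → z i = z' i) → X z = X z')
    {F : 𝒳 × (J → E) → ℝ≥0∞} (hF : Measurable F) :
    ∫⁻ z, F (X z, fun j => z (t, j)) ∂(Measure.infinitePi fun i : ℕ × J => μ i.2) =
      ∫⁻ z, ∫⁻ w, F (X z, w) ∂(Measure.infinitePi μ)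
        ∂(Measure.infinitePi fun i : ℕ × J => μ i.2) := by
  classical
  have := Fintype.ofFinite J
  set κ := Measure.infinitePi fun i : ℕ × J => μ i.2 with hκ
  have hne : Nonempty (ℕ × J → E) := by
    by_contra h
    rw [not_nonempty_iff] at h
    have h1 : κ Set.univ = 1 := measure_univ
    rw [Set.univ_eq_empty_iff.2 h] at h1
    simp at h1
  obtain ⟨z₀⟩ := hne
  let P : Finset (ℕ × J) := Finset.range t ×ˢ Finset.univ
  let Q : Finset (ℕ × J) := {t} ×ˢ Finset.univ
  have hPQ : Disjoint P Q := by
    rw [Finset.disjoint_left]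
    rintro ⟨a, b⟩ h1 h2
    simp [P, Q] at h1 h2
    omega
  have hind : iIndepFun (fun (i : ℕ × J) (z : ℕ × J → E) => z i) κ :=
    iIndepFun_infinitePi (fun _ => measurable_id)
  have h2 := hind.indepFun_finset P Q hPQ (fun i => measurable_pi_apply i)
  -- `X` sees only the coordinates in `P`. Filling the others with an arbitrary `z₀` writes `X` as a
  -- function of finitely many coordinates, which are independent of those in `Q`.
  let ext : (P → E) → (ℕ × J → E) := fun y i => if h : i ∈ P then y ⟨i, h⟩ else z₀ i
  have hext : Measurable ext := by
    refine measurable_pi_lambda _ fun i => ?_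
    by_cases h : i ∈ P
    · simp only [ext, h, dite_true]; fun_prop
    · simp only [ext, h, dite_false]; exact measurable_const
  let sl : (Q → E) → (J → E) := fun y j => y ⟨(t, j), by simp [Q]⟩
  have hsl : Measurable sl := by fun_prop
  have h3 := h2.comp (hX.comp hext) hsl
  have e1 : ((X ∘ ext) ∘ fun (a : ℕ × J → E) (i : P) => a i) = X := by
    funext z
    refine hX' _ _ fun i hi => ?_
    have : i ∈ P := by simp [P, hi]
    simp [ext, this]
  have e2 : (sl ∘ fun (a : ℕ × J → E) (i : Q) => a i) = fun z j => z (t, j) := rfl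
  rw [e1, e2] at h3
  have hY : Measurable fun (z : ℕ × J → E) (j : J) => z (t, j) := by fun_prop
  have hmap : κ.map (fun z j => z (t, j)) = Measure.infinitePi μ :=
    Measure.map_infinitePi_infinitePi_of_inj (P := fun i : ℕ × J => μ i.2)
      (f := fun j => (t, j)) (by intro a b h; simpa using h)
  have h4 := (indepFun_iff_map_prod_eq_prod_map_map hX.aemeasurable hY.aemeasurable).1 h3
  rw [← lintegral_map hF (hX.prodMk hY), h4, hmap, lintegral_prod _ hF.aemeasurable,
    lintegral_map (hF.lintegral_prod_right') hX]

end Independence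

section OneStep

variable {U : Type*} {S A : Type} {H : ℕ}

theorem MDP.history_congr (M : MDP S A H) (alg : SamplingRule U S A H) (t : ℕ) (u : U)
    {z z' : Noise S A H} (h : ∀ i, i.1 < t → z i = z' i) :
    M.history alg t (u, z) = M.history alg t (u, z') := by
  funext i
  simp only [MDP.history]
  rw [MDP.episode, MDP.episode]
  have ih := MDP.history_congr M alg i u (z := z) (z' := z') fun j hj => h j (hj.trans i.2)
  have e : (fun (h : Fin H) s a => z (i, h, s, a)) = fun h s a => z' (i, h, s, a) := by
    funext k s a
    exact h _ i.2
  simp only [e]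
  congr 2
termination_by t
decreasing_by exact i.2

variable [MeasurableSpace U] [MeasurableSpace S]

instance (M : MDP S A H) (ν : Measure U) [IsProbabilityMeasure ν] :
    IsProbabilityMeasure (M.law ν) := by
  unfold MDP.law; infer_instance

theorem MDP.law_ofDet (s₁ : S) (next : Fin H → S → A → S)
    (m : Fin H → S → A → ℝ) (ν : Measure U) :
    (MDP.ofDet s₁ next m).law ν = ν.prod (Measure.infinitePi fun i : ℕ × Fin H × S × A =>
      (gaussianReal (m i.2.1 i.2.2.1 i.2.2.2) 1).prod
        (Measure.dirac (next i.2.1 i.2.2.1 i.2.2.2))) := by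
  simp only [MDP.law, MDP.ofDet, PMF.toMeasure_pure]

variable [Finite S] [MeasurableSingletonClass S]

/-- The joint law of the rewards along the trajectory of `π`. -/
noncomputable def pathRewardLaw (s₁ : S) (next : Fin H → S → A → S) (m : Fin H → S → A → ℝ)
    (π : Policy S A H) : Measure (Fin H → ℝ) :=
  Measure.pi fun h => gaussianReal (m h (detState s₁ next π h) (detAction s₁ next π h)) 1

instance (s₁ : S) (next : Fin H → S → A → S) (m : Fin H → S → A → ℝ) (π : Policy S A H) :
    IsProbabilityMeasure (pathRewardLaw s₁ next m π) := by
  unfold pathRewardLaw; infer_instance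

/-- Almost surely all next states in the table agree with `next`, so the path is not random and
reads one fixed entry per stage. These entries are distinct, hence their rewards are independent. -/
theorem lintegral_rollout_ofDet [Finite A] [MeasurableSpace A] (s₁ : S) (next : Fin H → S → A → S)
    (m : Fin H → S → A → ℝ) (π : Policy S A H) {F : Episode S A H → ℝ≥0∞} (hF : Measurable F) :
    ∫⁻ w, F (rollout s₁ π fun h s a => w (h, s, a))
      ∂(Measure.infinitePi fun j : Fin H × S × A =>
        (gaussianReal (m j.1 j.2.1 j.2.2) 1).prod (Measure.dirac (next j.1 j.2.1 j.2.2))) =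
      ∫⁻ r, F (detEpisode s₁ next π r) ∂(pathRewardLaw s₁ next m π) := by
  set σ := Measure.infinitePi fun j : Fin H × S × A =>
        (gaussianReal (m j.1 j.2.1 j.2.2) 1).prod (Measure.dirac (next j.1 j.2.1 j.2.2)) with hσ
  have hae : ∀ᵐ w ∂σ, ∀ j : Fin H × S × A, (w j).2 = next j.1 j.2.1 j.2.2 := by
    rw [ae_all_iff]
    intro j
    have hmp := measurePreserving_eval_infinitePi (fun j : Fin H × S × A =>
        (gaussianReal (m j.1 j.2.1 j.2.2) 1).prod (Measure.dirac (next j.1 j.2.1 j.2.2))) j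
    have : ∀ᵐ y ∂((gaussianReal (m j.1 j.2.1 j.2.2) 1).prod
        (Measure.dirac (next j.1 j.2.1 j.2.2))), y.2 = next j.1 j.2.1 j.2.2 := by
      rw [Measure.ae_prod_iff_ae_ae]
      · filter_upwards with x
        rw [ae_dirac_iff]
        exact measurableSet_eq
      · exact measurableSet_eq_fun measurable_snd measurable_const
    exact hmp.quasiMeasurePreserving.ae this
  let i : Fin H → Fin H × S × A := fun h => (h, detState s₁ next π h, detAction s₁ next π h)
  have hi : Function.Injective i := fun a b h => by simpa [i] using congrArg Prod.fst h
  have hmap : σ.map (fun w h => (w (i h)).1) = pathRewardLaw s₁ next m π := by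
    have h1 : σ.map (fun w h => w (i h)) = Measure.infinitePi (fun h => _) :=
      Measure.map_infinitePi_infinitePi_of_inj (P := fun j : Fin H × S × A =>
        (gaussianReal (m j.1 j.2.1 j.2.2) 1).prod (Measure.dirac (next j.1 j.2.1 j.2.2))) hi
    have : (fun (w : Fin H × S × A → ℝ × S) h => (w (i h)).1) =
        (fun (v : Fin H → ℝ × S) h => (v h).1) ∘ (fun w h => w (i h)) := rfl
    rw [this, ← Measure.map_map (by fun_prop) (by fun_prop), h1,
      Measure.infinitePi_map_pi _ (fun h => measurable_fst)]
    simp [pathRewardLaw, Measure.infinitePi_eq_pi, i, Measure.map_fst_prod]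
  have hdet : Measurable fun r => detEpisode s₁ next π r := by
    unfold detEpisode
    fun_prop
  rw [← hmap, lintegral_map (f := fun r => F (detEpisode s₁ next π r)) (hF.comp hdet) (by fun_prop)]
  refine lintegral_congr_ae ?_
  filter_upwards [hae] with w hw
  rw [rollout_eq_detEpisode s₁ π (next := next) (fun h s a => hw (h, s, a))]

variable [MeasurableSpace A] [Finite A] [MeasurableSingletonClass A]

/-- The law of one episode given seed and past, in an MDP with deterministic transitions. -/
theorem MDP.lintegral_episode_ofDet (s₁ : S) (next : Fin H → S → A → S)
    (m : Fin H → S → A → ℝ) (ν : Measure U) [IsProbabilityMeasure ν]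
    {alg : SamplingRule U S A H} (halg : alg.IsMeasurable) (t : ℕ)
    {F : (U × History S A H t) × Episode S A H → ℝ≥0∞} (hF : Measurable F) :
    ∫⁻ ω, F ((ω.1, (MDP.ofDet s₁ next m).history alg t ω), (MDP.ofDet s₁ next m).episode alg ω t)
      ∂((MDP.ofDet s₁ next m).law ν) =
    ∫⁻ ω, ∫⁻ r, F ((ω.1, (MDP.ofDet s₁ next m).history alg t ω),
        detEpisode s₁ next ((MDP.ofDet s₁ next m).policyAt alg t ω) r)
      ∂(pathRewardLaw s₁ next m ((MDP.ofDet s₁ next m).policyAt alg t ω))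
      ∂((MDP.ofDet s₁ next m).law ν) := by
  set M := MDP.ofDet s₁ next m with hM
  have hinit : M.init = s₁ := rfl
  have hh := M.measurable_history halg t
  let G : (U × History S A H t) × (Fin H × S × A → ℝ × S) → ℝ≥0∞ := fun p =>
    F (p.1, rollout s₁ (alg t p.1.1 p.1.2) fun h s a => p.2 (h, s, a))
  have hG : Measurable G := by
    refine hF.comp (measurable_fst.prodMk ?_)
    refine (measurable_rollout s₁).comp (((halg t).comp measurable_fst).prodMk ?_)
    fun_prop
  have hep : ∀ ω : U × Noise S A H, F ((ω.1, M.history alg t ω), M.episode alg ω t) =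
      G ((ω.1, M.history alg t ω), fun j => ω.2 (t, j)) := by
    intro ω
    rw [MDP.episode]
    rfl
  simp_rw [hep]
  have hinner : ∀ x : U × History S A H t,
      ∫⁻ r, F (x, detEpisode s₁ next (alg t x.1 x.2) r)
        ∂(pathRewardLaw s₁ next m (alg t x.1 x.2)) =
      ∫⁻ w, G (x, w) ∂(Measure.infinitePi fun j : Fin H × S × A =>
        (gaussianReal (m j.1 j.2.1 j.2.2) 1).prod (Measure.dirac (next j.1 j.2.1 j.2.2))) := by
    intro x
    exact (lintegral_rollout_ofDet s₁ next m (alg t x.1 x.2) (F := fun e => F (x, e))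
      (hF.comp measurable_prodMk_left)).symm
  have hinner' : ∀ ω : U × Noise S A H, _ := fun ω => hinner (ω.1, M.history alg t ω)
  simp only [MDP.policyAt]
  simp_rw [hinner']
  rw [hM, MDP.law_ofDet, ← hM]
  have hx : Measurable fun ω : U × Noise S A H => (ω.1, M.history alg t ω) :=
    measurable_fst.prodMk hh
  rw [lintegral_prod _ (Measurable.aemeasurable ?_), lintegral_prod _ (Measurable.aemeasurable ?_)]
  · refine lintegral_congr fun u => ?_
    exact lintegral_infinitePi_slice (fun j : Fin H × S × A =>
        (gaussianReal (m j.1 j.2.1 j.2.2) 1).prod (Measure.dirac (next j.1 j.2.1 j.2.2))) t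
      (X := fun z => (u, M.history alg t (u, z))) (hx.comp measurable_prodMk_left)
      (fun z z' h => by rw [M.history_congr alg t u h]) hG
  · exact (hG.lintegral_prod_right').comp hx
  · refine hG.comp (hx.prodMk ?_)
    fun_prop

end OneStep

/-! ### Exponential tilting of one Gaussian coordinate -/

section Tilting

/-- A density in one coordinate of a product measure. -/
theorem pi_withDensity_eval {ι : Type*} [Fintype ι] [DecidableEq ι] {E : Type*} [MeasurableSpace E]
    (μ : ι → Measure E) [∀ j, IsProbabilityMeasure (μ j)] (i : ι) {g : E → ℝ≥0∞} (hg : Measurable g)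
    {ρ : Measure E} [IsProbabilityMeasure ρ] (hρ : ρ = (μ i).withDensity g) :
    Measure.pi (Function.update μ i ρ) = (Measure.pi μ).withDensity fun r => g (r i) := by
  have hinst : ∀ j, IsProbabilityMeasure (Function.update μ i ρ j) := by
    intro j
    by_cases h : j = i
    · subst h; simpa
    · simpa [h] using (inferInstance : IsProbabilityMeasure (μ j))
  refine Measure.pi_eq fun s hs => ?_
  -- The density is charged to the factor `i`, so that density times indicator of a box is a product
  -- of functions of single coordinates.
  let φ : ι → E → ℝ≥0∞ := fun j x => (s j).indicator (if j = i then g else 1) x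
  have hφ : ∀ j, Measurable (φ j) := by
    intro j
    refine Measurable.indicator ?_ (hs j)
    split_ifs
    · exact hg
    · exact measurable_one
  have hprod : ∀ r : ι → E, (Set.univ.pi s).indicator (fun r => g (r i)) r = ∏ j, φ j (r j) := by
    intro r
    by_cases hr : r ∈ Set.univ.pi s
    · rw [Set.indicator_of_mem hr, Finset.prod_eq_single i]
      · simp [φ, hr i (Set.mem_univ i)]
      · intro j _ hj
        simp [φ, hr j (Set.mem_univ j), hj]
      · simp
    · rw [Set.indicator_of_notMem hr]
      simp only [Set.mem_univ_pi, not_forall] at hr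
      obtain ⟨j, hj⟩ := hr
      symm
      apply Finset.prod_eq_zero (Finset.mem_univ j)
      simp [φ, hj]
  rw [withDensity_apply _ (MeasurableSet.univ_pi hs),
    ← lintegral_indicator (MeasurableSet.univ_pi hs)]
  simp_rw [hprod]
  rw [lintegral_prod_eq_prod_lintegral_of_indepFun Finset.univ (fun j (r : ι → E) => φ j (r j))
    (iIndepFun_pi fun j => (hφ j).aemeasurable) (fun j => (hφ j).comp (measurable_pi_apply j))]
  refine Finset.prod_congr rfl fun j _ => ?_
  have hmp := measurePreserving_eval μ j
  have : ∫⁻ r, φ j (r j) ∂(Measure.pi μ) = ∫⁻ x, φ j x ∂(μ j) := by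
    rw [← hmp.map_eq, lintegral_map (hφ j) (measurable_pi_apply j)]
  rw [this]
  by_cases h : j = i
  · subst h
    simp only [φ, if_true]
    rw [lintegral_indicator (hs j), Function.update_self, hρ, withDensity_apply _ (hs j)]
  · simp [φ, h, lintegral_indicator (hs j)]

theorem gaussianReal_add_eq_withDensity (m l : ℝ) :
    gaussianReal (m + l) 1 = (gaussianReal m 1).withDensity
      fun x => ENNReal.ofReal (Real.exp (l * (x - m) - l ^ 2 / 2)) := by
  rw [gaussianReal_of_var_ne_zero _ one_ne_zero, gaussianReal_of_var_ne_zero _ one_ne_zero,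
    ← withDensity_mul _ (measurable_gaussianPDF _ _) (by fun_prop)]
  congr 1
  funext x
  simp only [Pi.mul_apply, gaussianPDF]
  rw [← ENNReal.ofReal_mul (gaussianPDFReal_nonneg _ _ _)]
  congr 1
  simp only [gaussianPDFReal, NNReal.coe_one]
  rw [mul_assoc _ (Real.exp _) (Real.exp _), ← Real.exp_add]
  congr 2
  ring

end Tilting

/-! ### Rewards at a single stage, and the likelihood ratio of an episode -/

section Leaf

variable {U : Type*} {S A : Type} {H : ℕ}

/-- Mean rewards that vanish except at stage `h₀`, where they are given by `f`. -/
def leafMeans (h₀ : Fin H) (f : S × A → ℝ) (h : Fin H) (s : S) (a : A) : ℝ :=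
  if h = h₀ then f (s, a) else 0

/-- The state-action pair visited by `π` at stage `h₀`. -/
def leafOf (s₁ : S) (next : Fin H → S → A → S) (h₀ : Fin H) (π : Policy S A H) : S × A :=
  (detState s₁ next π h₀, detAction s₁ next π h₀)

/-- The state-action pair at stage `h₀` of an episode. -/
def leafPair (h₀ : Fin H) (e : Episode S A H) : S × A := ((e h₀).1, (e h₀).2.1)

/-- The reward at stage `h₀` of an episode. -/
def leafReward (h₀ : Fin H) (e : Episode S A H) : ℝ := (e h₀).2.2

@[simp] theorem leafPair_detEpisode (s₁ : S) (next : Fin H → S → A → S) (h₀ : Fin H)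
    (π : Policy S A H) (r : Fin H → ℝ) :
    leafPair h₀ (detEpisode s₁ next π r) = leafOf s₁ next h₀ π := rfl

@[simp] theorem leafReward_detEpisode (s₁ : S) (next : Fin H → S → A → S) (h₀ : Fin H)
    (π : Policy S A H) (r : Fin H → ℝ) :
    leafReward h₀ (detEpisode s₁ next π r) = r h₀ := rfl

/-- The deterministic MDP whose only non-centered rewards are those at stage `h₀`, with
means `f`. -/
noncomputable abbrev leafMDP (s₁ : S) (next : Fin H → S → A → S) (h₀ : Fin H) (f : S × A → ℝ) :
    MDP S A H :=
  MDP.ofDet s₁ next (leafMeans h₀ f)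

theorem value_leafMDP [Fintype S] (s₁ : S) (next : Fin H → S → A → S) (h₀ : Fin H)
    (f : S × A → ℝ) (π : Policy S A H) :
    (leafMDP s₁ next h₀ f).value π = f (leafOf s₁ next h₀ π) := by
  rw [MDP.value_ofDet]
  simp [leafMeans, leafOf]

theorem lintegral_pathRewardLaw_leaf (s₁ : S) (next : Fin H → S → A → S) (h₀ : Fin H)
    (f : S × A → ℝ) (π : Policy S A H) {g : ℝ → ℝ≥0∞} (hg : Measurable g) :
    ∫⁻ r, g (r h₀) ∂(pathRewardLaw s₁ next (leafMeans h₀ f) π) =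
      ∫⁻ x, g x ∂(gaussianReal (f (leafOf s₁ next h₀ π)) 1) := by
  have hmp := measurePreserving_eval (fun h => gaussianReal
    (leafMeans h₀ f h (detState s₁ next π h) (detAction s₁ next π h)) 1) h₀
  have : leafMeans h₀ f h₀ (detState s₁ next π h₀) (detAction s₁ next π h₀) =
      f (leafOf s₁ next h₀ π) := by simp [leafMeans, leafOf]
  rw [← this, ← hmp.map_eq, lintegral_map hg (measurable_pi_apply h₀)]
  rfl

variable [DecidableEq S] [DecidableEq A]

/-- The likelihood ratio of one episode, when the mean reward of `c` is increased from `m` to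
`m + l`. -/
noncomputable def leafTilt (h₀ : Fin H) (c : S × A) (m l : ℝ) (e : Episode S A H) : ℝ≥0∞ :=
  if leafPair h₀ e = c then
    ENNReal.ofReal (Real.exp (l * (leafReward h₀ e - m) - l ^ 2 / 2)) else 1

/-- A path passes stage `h₀` once. If it meets `c` there, exactly one Gaussian coordinate is
shifted; otherwise the law is unchanged and the tilt is one. -/
theorem lintegral_pathRewardLaw_update (s₁ : S) (next : Fin H → S → A → S) (h₀ : Fin H)
    (f : S × A → ℝ) (c : S × A) (l : ℝ) (π : Policy S A H) {F : (Fin H → ℝ) → ℝ≥0∞}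
    (hF : Measurable F) :
    ∫⁻ r, F r ∂(pathRewardLaw s₁ next (leafMeans h₀ (Function.update f c (f c + l))) π) =
      ∫⁻ r, F r * leafTilt h₀ c (f c) l (detEpisode s₁ next π r)
        ∂(pathRewardLaw s₁ next (leafMeans h₀ f) π) := by
  simp only [leafTilt, leafPair_detEpisode, leafReward_detEpisode]
  by_cases hc : leafOf s₁ next h₀ π = c
  · simp only [hc, if_true]
    have hg : Measurable fun x : ℝ => ENNReal.ofReal (Real.exp (l * (x - f c) - l ^ 2 / 2)) := by
      fun_prop
    have hm : leafMeans h₀ f h₀ (detState s₁ next π h₀) (detAction s₁ next π h₀) = f c := by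
      rw [← hc]; simp [leafMeans, leafOf]
    have hρ : gaussianReal (f c + l) 1 = (gaussianReal
        (leafMeans h₀ f h₀ (detState s₁ next π h₀) (detAction s₁ next π h₀)) 1).withDensity
        fun x => ENNReal.ofReal (Real.exp (l * (x - f c) - l ^ 2 / 2)) := by
      rw [hm, gaussianReal_add_eq_withDensity]
    have hfam : (fun h => gaussianReal (leafMeans h₀ (Function.update f c (f c + l)) h
        (detState s₁ next π h) (detAction s₁ next π h)) 1) =
        Function.update (fun h => gaussianReal (leafMeans h₀ f h
          (detState s₁ next π h) (detAction s₁ next π h)) 1) h₀ (gaussianReal (f c + l) 1) := by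
      funext h
      by_cases hh : h = h₀
      · subst hh
        have : (detState s₁ next π h, detAction s₁ next π h) = c := hc
        simp [leafMeans, this]
      · simp [leafMeans, hh]
    have : pathRewardLaw s₁ next (leafMeans h₀ (Function.update f c (f c + l))) π =
        (pathRewardLaw s₁ next (leafMeans h₀ f) π).withDensity
          fun r => ENNReal.ofReal (Real.exp (l * (r h₀ - f c) - l ^ 2 / 2)) := by
      unfold pathRewardLaw
      rw [hfam]
      exact pi_withDensity_eval _ h₀ hg hρ
    have hg' : Measurable fun r : Fin H → ℝ =>
        ENNReal.ofReal (Real.exp (l * (r h₀ - f c) - l ^ 2 / 2)) :=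
      hg.comp (measurable_pi_apply h₀)
    rw [this, lintegral_withDensity_eq_lintegral_mul _ hg' hF]
    simp only [Pi.mul_apply, mul_comm]
  · simp only [hc, if_false, mul_one]
    have : pathRewardLaw s₁ next (leafMeans h₀ (Function.update f c (f c + l))) π =
        pathRewardLaw s₁ next (leafMeans h₀ f) π := by
      unfold pathRewardLaw
      congr 1
      funext h
      by_cases hh : h = h₀
      · subst hh
        have : (detState s₁ next π h, detAction s₁ next π h) ≠ c := hc
        simp [leafMeans, this]
      · simp [leafMeans, hh]
    rw [this]

theorem lintegral_leafTilt (s₁ : S) (next : Fin H → S → A → S) (h₀ : Fin H)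
    (f : S × A → ℝ) (c : S × A) (l : ℝ) (π : Policy S A H) :
    ∫⁻ r, leafTilt h₀ c (f c) l (detEpisode s₁ next π r)
      ∂(pathRewardLaw s₁ next (leafMeans h₀ f) π) = 1 := by
  have := lintegral_pathRewardLaw_update s₁ next h₀ f c l π (F := fun _ => 1) measurable_const
  simpa using this.symm

end Leaf

section TiltMeasurability

variable {U : Type*} {S A : Type} {H : ℕ} [MeasurableSpace U]
  [MeasurableSpace S] [Finite S] [MeasurableSingletonClass S] [DecidableEq S]
  [MeasurableSpace A] [Finite A] [MeasurableSingletonClass A] [DecidableEq A]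

omit [Finite S] [MeasurableSingletonClass S] [DecidableEq S] [Finite A]
  [MeasurableSingletonClass A] [DecidableEq A] in
theorem measurable_leafPair (h₀ : Fin H) :
    Measurable (leafPair h₀ : Episode S A H → S × A) := by
  unfold leafPair; fun_prop

omit [Finite S] [MeasurableSingletonClass S] [DecidableEq S] [Finite A]
  [MeasurableSingletonClass A] [DecidableEq A] in
theorem measurable_leafReward (h₀ : Fin H) :
    Measurable (leafReward h₀ : Episode S A H → ℝ) := by
  unfold leafReward; fun_prop

omit [Finite S] [MeasurableSingletonClass S] [DecidableEq S] [Finite A]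
  [MeasurableSingletonClass A] [DecidableEq A] in
theorem measurable_detEpisode (s₁ : S) (next : Fin H → S → A → S) (π : Policy S A H) :
    Measurable fun r => detEpisode s₁ next π r := by
  unfold detEpisode; fun_prop

omit [Finite S] [Finite A] in
theorem measurable_leafTilt (h₀ : Fin H) (c : S × A) (m l : ℝ) :
    Measurable (leafTilt h₀ c m l : Episode S A H → ℝ≥0∞) := by
  have := measurable_leafReward (S := S) (A := A) h₀
  exact Measurable.ite (measurable_leafPair h₀ (measurableSet_singleton c)) (by fun_prop)
    measurable_const

end TiltMeasurability

/-! ### Likelihood ratios of histories -/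

section History

variable {U : Type*} {S A : Type} {H : ℕ}

theorem MDP.history_succ (M : MDP S A H) (alg : SamplingRule U S A H) (t : ℕ)
    (ω : U × Noise S A H) :
    M.history alg (t + 1) ω =
      Fin.snoc (α := fun _ => Episode S A H) (M.history alg t ω) (M.episode alg ω t) := by
  funext i
  refine Fin.lastCases ?_ (fun j => ?_) i
  · simp [MDP.history]
  · simp [MDP.history]

/-- Meant for `α` the space of policies: a quantity that depends on the policy chosen from the past
can be checked policy by policy. -/
theorem measurable_comp_of_countable {α 𝒳 E : Type*} [MeasurableSpace α] [Countable α]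
    [MeasurableSingletonClass α] [MeasurableSpace 𝒳] [MeasurableSpace E] {p : 𝒳 → α}
    (hp : Measurable p) {Ψ : α → 𝒳 → E} (hΨ : ∀ a, Measurable (Ψ a)) :
    Measurable fun x => Ψ (p x) x := by
  have : Measurable fun q : α × 𝒳 => Ψ q.1 q.2 := measurable_from_prod_countable_right hΨ
  exact this.comp (hp.prodMk measurable_id)

/-- The beginning of a history. -/
def History.take {n : ℕ} (e : History S A H n) (i : Fin n) : History S A H i :=
  fun j => e (Fin.castLE i.2.le j)

theorem measurable_snoc [MeasurableSpace S] [MeasurableSpace A] (t : ℕ) :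
    Measurable fun p : History S A H t × Episode S A H =>
      (Fin.snoc (α := fun _ => Episode S A H) p.1 p.2 : History S A H (t + 1)) := by
  refine measurable_pi_lambda _ fun i => ?_
  refine Fin.lastCases ?_ (fun j => ?_) i
  · simpa using measurable_snd
  · simp only [Fin.snoc_castSucc]
    exact (measurable_pi_apply j).comp measurable_fst

variable [DecidableEq S] [DecidableEq A]

/-- The likelihood ratio of a history. -/
noncomputable def histTilt (h₀ : Fin H) (c : S × A) (m l : ℝ) {t : ℕ} (e : History S A H t) :
    ℝ≥0∞ :=
  ∏ i, leafTilt h₀ c m l (e i)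

open Classical in
/-- The likelihood ratio of those episodes that take place while the gate `g` is open. -/
noncomputable def gatedTilt (g : (i : ℕ) → Set (U × History S A H i)) (h₀ : Fin H) (c : S × A)
    (m l : ℝ) (n : ℕ) (x : U × History S A H n) : ℝ≥0∞ :=
  ∏ i : Fin n, if (x.1, x.2.take i) ∈ g i then leafTilt h₀ c m l (x.2 i) else 1

-- The gate at time `n` looks only at the first `n` episodes, so a further episode enters through a
-- single factor.
open Classical in
theorem gatedTilt_snoc (g : (i : ℕ) → Set (U × History S A H i)) (h₀ : Fin H) (c : S × A)
    (m l : ℝ) (n : ℕ) (u : U) (e : History S A H n) (e' : Episode S A H) :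
    gatedTilt g h₀ c m l (n + 1) (u, Fin.snoc (α := fun _ => Episode S A H) e e') =
      gatedTilt g h₀ c m l n (u, e) *
        if (u, e) ∈ g n then leafTilt h₀ c m l e' else 1 := by
  unfold gatedTilt
  rw [Fin.prod_univ_castSucc]
  have h1 : ∀ i : Fin n, History.take (Fin.snoc (α := fun _ => Episode S A H) e e' :
      History S A H (n + 1)) i.castSucc = e.take i := by
    intro i
    funext j
    exact Fin.snoc_castSucc (α := fun _ => Episode S A H) e' e (Fin.castLE i.2.le j)
  have h2 : History.take (Fin.snoc (α := fun _ => Episode S A H) e e' :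
      History S A H (n + 1)) (Fin.last n) = e := by
    funext j
    exact Fin.snoc_castSucc (α := fun _ => Episode S A H) e' e j
  simp only [Fin.snoc_castSucc, Fin.snoc_last, h1, h2, Fin.val_castSucc, Fin.val_last]

end History

/-! ### Change of measure and the martingale property -/

section ChangeOfMeasure

variable {U : Type*} {S A : Type} {H : ℕ} [MeasurableSpace U]
  [MeasurableSpace S] [Finite S] [MeasurableSingletonClass S] [DecidableEq S]
  [MeasurableSpace A] [Finite A] [MeasurableSingletonClass A] [DecidableEq A]

omit [Finite S] [Finite A] in
theorem measurable_histTilt (h₀ : Fin H) (c : S × A) (m l : ℝ) (t : ℕ) :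
    Measurable fun e : History S A H t => histTilt h₀ c m l e :=
  Finset.measurable_prod _ fun i _ => (measurable_leafTilt h₀ c m l).comp (measurable_pi_apply i)

omit [Finite S] [Finite A] in
theorem measurable_gatedTilt {g : (i : ℕ) → Set (U × History S A H i)}
    (hg : ∀ i, MeasurableSet (g i)) (h₀ : Fin H) (c : S × A) (m l : ℝ) (n : ℕ) :
    Measurable (gatedTilt g h₀ c m l n) := by
  refine Finset.measurable_prod _ fun i _ => ?_
  have h1 : Measurable fun x : U × History S A H n => (x.1, x.2.take i) := by
    unfold History.take
    fun_prop
  exact Measurable.ite (h1 (hg i))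
    ((measurable_leafTilt h₀ c m l).comp ((measurable_pi_apply i).comp measurable_snd))
    measurable_const

variable (s₁ : S) (next : Fin H → S → A → S) (h₀ : Fin H) (f : S × A → ℝ) (c : S × A) (l : ℝ)
  (ν : Measure U) [IsProbabilityMeasure ν] {alg : SamplingRule U S A H} (halg : alg.IsMeasurable)

-- Induction on `t`: the last episode is tilted by `lintegral_pathRewardLaw_update`, and its
-- integral `Φ` is a function of the past, to which the induction hypothesis applies.
include halg in
theorem lintegral_history_update (t : ℕ) {F : U × History S A H t → ℝ≥0∞} (hF : Measurable F) :
    ∫⁻ ω, F (ω.1, (leafMDP s₁ next h₀ (Function.update f c (f c + l))).history alg t ω)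
      ∂((leafMDP s₁ next h₀ (Function.update f c (f c + l))).law ν) =
    ∫⁻ ω, F (ω.1, (leafMDP s₁ next h₀ f).history alg t ω) *
        histTilt h₀ c (f c) l ((leafMDP s₁ next h₀ f).history alg t ω)
      ∂((leafMDP s₁ next h₀ f).law ν) := by
  induction t with
  | zero =>
    have hM : ∀ M : MDP S A H, ∀ ω, M.history alg 0 ω = Fin.elim0 := fun M ω => by
      funext i; exact i.elim0
    simp only [hM, histTilt, Finset.univ_eq_empty, Finset.prod_empty, mul_one]
    rw [MDP.law_ofDet, MDP.law_ofDet]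
    have hF' : Measurable fun u : U => F (u, Fin.elim0) := hF.comp (by fun_prop)
    rw [lintegral_prod (fun z => F (z.1, Fin.elim0)) (hF'.comp measurable_fst).aemeasurable,
      lintegral_prod (fun z => F (z.1, Fin.elim0)) (hF'.comp measurable_fst).aemeasurable]
    simp
  | succ t ih =>
    let sn : (U × History S A H t) × Episode S A H → U × History S A H (t + 1) := fun p =>
      (p.1.1, Fin.snoc (α := fun _ => Episode S A H) p.1.2 p.2)
    have hsn : Measurable sn := by
      refine (measurable_fst.comp measurable_fst).prodMk ?_
      exact (measurable_snoc t).comp ((measurable_snd.comp measurable_fst).prodMk measurable_snd)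
    let G : (U × History S A H t) × Episode S A H → ℝ≥0∞ := fun p =>
      F (sn p) * leafTilt h₀ c (f c) l p.2
    have hG : Measurable G :=
      (hF.comp hsn).mul ((measurable_leafTilt h₀ c (f c) l).comp measurable_snd)
    let Φ : U × History S A H t → ℝ≥0∞ := fun x =>
      ∫⁻ r, G (x, detEpisode s₁ next (alg t x.1 x.2) r)
        ∂(pathRewardLaw s₁ next (leafMeans h₀ f) (alg t x.1 x.2))
    have hΦ : Measurable Φ := by
      let Ψ : Policy S A H → U × History S A H t → ℝ≥0∞ := fun π x =>
        ∫⁻ r, G (x, detEpisode s₁ next π r) ∂(pathRewardLaw s₁ next (leafMeans h₀ f) π)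
      have hΨ : ∀ π, Measurable (Ψ π) := fun π => by
        have hq : Measurable fun q : (U × History S A H t) × (Fin H → ℝ) =>
            G (q.1, detEpisode s₁ next π q.2) :=
          hG.comp (measurable_fst.prodMk ((measurable_detEpisode s₁ next π).comp measurable_snd))
        exact hq.lintegral_prod_right' (ν := pathRewardLaw s₁ next (leafMeans h₀ f) π)
      exact measurable_comp_of_countable (halg t) hΨ
    simp_rw [MDP.history_succ]
    have e1 := MDP.lintegral_episode_ofDet s₁ next
      (leafMeans h₀ (Function.update f c (f c + l))) ν halg t (hF.comp hsn)
    simp only [Function.comp_apply, sn] at e1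
    rw [e1]
    have e2 := ih hΦ
    have e3 := MDP.lintegral_episode_ofDet s₁ next (leafMeans h₀ f) ν halg t
      (F := fun p => G p * histTilt h₀ c (f c) l p.1.2)
      (hG.mul ((measurable_histTilt h₀ c (f c) l t).comp (measurable_snd.comp measurable_fst)))
    refine Eq.trans ?_ (e2.trans (Eq.trans ?_ (e3.symm.trans ?_)))
    · refine lintegral_congr fun ω => ?_
      set M' := leafMDP s₁ next h₀ (Function.update f c (f c + l))
      have hm : Measurable fun r => F (sn ((ω.1, M'.history alg t ω),
          detEpisode s₁ next (M'.policyAt alg t ω) r)) :=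
        (hF.comp hsn).comp (measurable_prodMk_left.comp (measurable_detEpisode s₁ next _))
      exact lintegral_pathRewardLaw_update s₁ next h₀ f c l _ hm
    · refine lintegral_congr fun ω => ?_
      set M := leafMDP s₁ next h₀ f
      have hm : Measurable fun r => G ((ω.1, M.history alg t ω),
          detEpisode s₁ next (M.policyAt alg t ω) r) :=
        hG.comp (measurable_prodMk_left.comp (measurable_detEpisode s₁ next _))
      exact (lintegral_mul_const _ hm).symm
    · refine lintegral_congr fun ω => ?_
      simp only [G, sn, histTilt]
      rw [Fin.prod_univ_castSucc]
      simp only [Fin.snoc_castSucc, Fin.snoc_last]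
      rw [mul_assoc]
      congr 1
      rw [mul_comm]

-- Martingale property: the gate is decided before the episode, so the factor of that episode has
-- conditional mean one whether the gate is open or closed.
include halg in
theorem lintegral_gatedTilt {g : (i : ℕ) → Set (U × History S A H i)}
    (hg : ∀ i, MeasurableSet (g i)) (n : ℕ) :
    ∫⁻ ω, gatedTilt g h₀ c (f c) l n (ω.1, (leafMDP s₁ next h₀ f).history alg n ω)
      ∂((leafMDP s₁ next h₀ f).law ν) = 1 := by
  classical
  induction n with
  | zero => simp [gatedTilt]
  | succ n ih =>
    simp_rw [MDP.history_succ, gatedTilt_snoc]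
    have hm : Measurable fun p : (U × History S A H n) × Episode S A H =>
        gatedTilt g h₀ c (f c) l n p.1 *
          if p.1 ∈ g n then leafTilt h₀ c (f c) l p.2 else 1 := by
      refine ((measurable_gatedTilt hg h₀ c (f c) l n).comp measurable_fst).mul ?_
      exact Measurable.ite (measurable_fst (hg n))
        ((measurable_leafTilt h₀ c (f c) l).comp measurable_snd) measurable_const
    have e := MDP.lintegral_episode_ofDet s₁ next (leafMeans h₀ f) ν halg n hm
    refine e.trans (Eq.trans ?_ ih)
    refine lintegral_congr fun ω => ?_
    dsimp only
    split_ifs with h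
    · have hm' : Measurable fun r => leafTilt h₀ c (f c) l (detEpisode s₁ next
          ((leafMDP s₁ next h₀ f).policyAt alg n ω) r) :=
        (measurable_leafTilt h₀ c (f c) l).comp (measurable_detEpisode s₁ next _)
      rw [lintegral_const_mul _ hm', lintegral_leafTilt, mul_one]
    · simp

open Classical in
/-- The centered reward of `c` in episode `i`, if `c` is visited while the gate is open. -/
noncomputable def gatedReward (g : (i : ℕ) → Set (U × History S A H i)) (h₀ : Fin H) (c : S × A)
    (m : ℝ) (i : ℕ) (p : (U × History S A H i) × Episode S A H) : ℝ :=
  if p.1 ∈ g i ∧ leafPair h₀ p.2 = c then leafReward h₀ p.2 - m else 0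

omit [Finite S] [Finite A] in
theorem measurable_gatedReward {g : (i : ℕ) → Set (U × History S A H i)}
    (hg : ∀ i, MeasurableSet (g i)) (h₀ : Fin H) (c : S × A) (m : ℝ) (i : ℕ) :
    Measurable (gatedReward g h₀ c m i) := by
  refine Measurable.ite ?_ ?_ measurable_const
  · exact (measurable_fst (hg i)).inter
      (((measurable_leafPair h₀).comp measurable_snd) (measurableSet_singleton c))
  · exact ((measurable_leafReward h₀).comp measurable_snd).sub_const m

theorem integrable_sub_gaussianReal (m m' : ℝ) :
    Integrable (fun x => x - m') (gaussianReal m 1) :=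
  ((memLp_id_gaussianReal 1).integrable le_rfl).sub (integrable_const m')

theorem lintegral_ofReal_neg_gaussianReal (m : ℝ) :
    ∫⁻ x, ENNReal.ofReal (x - m) ∂(gaussianReal m 1) =
      ∫⁻ x, ENNReal.ofReal (-(x - m)) ∂(gaussianReal m 1) := by
  have h : (gaussianReal m 1).map (fun x => 2 * m - x) = gaussianReal m 1 := by
    rw [gaussianReal_map_const_sub]
    congr 1
    ring
  conv_lhs => rw [← h]
  rw [lintegral_map (by fun_prop) (by fun_prop)]
  refine lintegral_congr fun x => ?_
  congr 1
  ring

-- Gate and visited pair are determined by the past, so given the past the reward is either zero or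
-- a centered Gaussian. The one-episode formula concerns lower integrals; norm, positive part and
-- negative part are therefore all read off from one identity for functions `φ` with `φ 0 = 0`.
include halg in
theorem integral_gatedReward {g : (i : ℕ) → Set (U × History S A H i)}
    (hg : ∀ i, MeasurableSet (g i)) (n : ℕ) :
    Integrable (fun ω => gatedReward g h₀ c (f c) n
      ((ω.1, (leafMDP s₁ next h₀ f).history alg n ω), (leafMDP s₁ next h₀ f).episode alg ω n))
      ((leafMDP s₁ next h₀ f).law ν) ∧
    ∫ ω, gatedReward g h₀ c (f c) n
      ((ω.1, (leafMDP s₁ next h₀ f).history alg n ω), (leafMDP s₁ next h₀ f).episode alg ω n)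
      ∂((leafMDP s₁ next h₀ f).law ν) = 0 := by
  classical
  set M := leafMDP s₁ next h₀ f with hM
  have hgm := measurable_gatedReward hg h₀ c (f c) n
  have hmeas : Measurable fun ω => gatedReward g h₀ c (f c) n
      ((ω.1, M.history alg n ω), M.episode alg ω n) :=
    hgm.comp ((measurable_fst.prodMk (M.measurable_history halg n)).prodMk
      (M.measurable_episode halg n))
  have key : ∀ φ : ℝ → ℝ≥0∞, Measurable φ → φ 0 = 0 →
      ∫⁻ ω, φ (gatedReward g h₀ c (f c) n ((ω.1, M.history alg n ω), M.episode alg ω n))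
        ∂(M.law ν) =
      ∫⁻ ω, (if (ω.1, M.history alg n ω) ∈ g n ∧ leafOf s₁ next h₀ (M.policyAt alg n ω) = c then
        ∫⁻ x, φ (x - f c) ∂(gaussianReal (f c) 1) else 0) ∂(M.law ν) := by
    intro φ hφ hφ0
    refine (MDP.lintegral_episode_ofDet s₁ next (leafMeans h₀ f) ν halg n (hφ.comp hgm)).trans ?_
    refine lintegral_congr fun ω => ?_
    by_cases h : (ω.1, M.history alg n ω) ∈ g n ∧ leafOf s₁ next h₀ (M.policyAt alg n ω) = c
    · rw [if_pos h]
      have e := lintegral_pathRewardLaw_leaf s₁ next h₀ f (M.policyAt alg n ω)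
        (g := fun x => φ (x - f c)) (hφ.comp (measurable_id.sub_const _))
      rw [h.2] at e
      rw [← e]
      refine lintegral_congr fun r => ?_
      exact congrArg φ (if_pos h)
    · rw [if_neg h]
      refine (lintegral_congr fun r => ?_).trans lintegral_zero
      exact (congrArg φ (if_neg h)).trans hφ0
  have hint : Integrable (fun ω => gatedReward g h₀ c (f c) n
      ((ω.1, M.history alg n ω), M.episode alg ω n)) (M.law ν) := by
    refine ⟨hmeas.aestronglyMeasurable, ?_⟩
    rw [hasFiniteIntegral_iff_enorm, key (fun x => ‖x‖ₑ) measurable_enorm (by simp)]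
    have hfin := (integrable_sub_gaussianReal (f c) (f c)).2
    rw [hasFiniteIntegral_iff_enorm] at hfin
    refine lt_of_le_of_lt (lintegral_mono (g := fun _ => ∫⁻ x, ‖x - f c‖ₑ ∂(gaussianReal (f c) 1))
      fun ω => ?_) ?_
    · dsimp only
      split_ifs
      · exact le_rfl
      · exact zero_le
    · simpa using hfin
  refine ⟨hint, ?_⟩
  rw [integral_eq_lintegral_pos_part_sub_lintegral_neg_part hint,
    key ENNReal.ofReal (by fun_prop) (by simp),
    key (fun x => ENNReal.ofReal (-x)) (by fun_prop) (by simp),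
    lintegral_ofReal_neg_gaussianReal, sub_self]

end ChangeOfMeasure

/-! ### The binary tree and its optimal value -/

section Tree

/-- Transitions of the binary tree: the state is the number spelled by the actions, in binary. -/
def treeNext {S : ℕ} (hS : 0 < S) (A H : ℕ) (_ : Fin H) (s : Fin S) (a : Fin A) : Fin S :=
  ⟨(2 * (s : ℕ) + if (a : ℕ) = 0 then 0 else 1) % S, Nat.mod_lt _ hS⟩

/-- The last stage. -/
def lastStage {H : ℕ} (hH : 0 < H) : Fin H := ⟨H - 1, Nat.sub_one_lt hH.ne'⟩

/-- The actions spell the binary digits of `s`, most significant first: after `k` steps the state is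
`s / 2 ^ (H - 1 - k)`. For `k = 0` this is zero by `hSH`, and it stays below `S`, so the reduction
modulo `S` never acts. The action of the last stage is free. -/
theorem leafOf_tree_surjective {S A H : ℕ} (hS : 0 < S) (hA : 2 ≤ A) (hH : 0 < H)
    (hSH : S ≤ 2 ^ (H - 1)) :
    Function.Surjective (leafOf (⟨0, hS⟩ : Fin S) (treeNext hS A H) (lastStage hH)) := by
  rintro ⟨s, a⟩
  let π : Policy (Fin S) (Fin A) H := fun h _ =>
    if (h : ℕ) = H - 1 then a
    else if ((s : ℕ) / 2 ^ (H - 1 - (h + 1))) % 2 = 0 then ⟨0, by omega⟩ else ⟨1, by omega⟩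
  have hst : ∀ k : ℕ, k ≤ H - 1 →
      ((detState (⟨0, hS⟩ : Fin S) (treeNext hS A H) π k : Fin S) : ℕ) = s / 2 ^ (H - 1 - k) := by
    intro k
    induction k with
    | zero =>
      intro _
      simp only [detState, stateAt, Nat.sub_zero]
      rw [Nat.div_eq_of_lt (s.2.trans_le hSH)]
    | succ k ih =>
      intro hk
      have hk' : k < H := by omega
      have e := detState_succ (⟨0, hS⟩ : Fin S) (treeNext hS A H) π ⟨k, hk'⟩
      simp only at e
      rw [e]
      simp only [treeNext]
      rw [ih (by omega)]
      have hpow : H - 1 - k = (H - 1 - (k + 1)) + 1 := by omega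
      have hdiv : (s : ℕ) / 2 ^ (H - 1 - k) = s / 2 ^ (H - 1 - (k + 1)) / 2 := by
        rw [hpow, pow_succ, Nat.div_div_eq_div_mul]
      have hact : detAction (⟨0, hS⟩ : Fin S) (treeNext hS A H) π ⟨k, hk'⟩ =
          if ((s : ℕ) / 2 ^ (H - 1 - (k + 1))) % 2 = 0 then ⟨0, by omega⟩ else ⟨1, by omega⟩ :=
        if_neg (by simp only; omega)
      have hπ : (if ((detAction (⟨0, hS⟩ : Fin S) (treeNext hS A H) π ⟨k, hk'⟩ : Fin A) : ℕ) = 0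
          then 0 else 1) = ((s : ℕ) / 2 ^ (H - 1 - (k + 1))) % 2 := by
        rw [hact]
        split_ifs with h1 h2 h2
        · exact h1.symm
        · exact absurd rfl h2
        · simp at h2
        · omega
      rw [hπ, hdiv, Nat.div_add_mod]
      exact Nat.mod_eq_of_lt ((Nat.div_le_self _ _).trans_lt s.2)
  refine ⟨π, ?_⟩
  refine Prod.ext (Fin.ext ?_) ?_
  · simp [leafOf, lastStage, hst]
  · simp [leafOf, detAction, lastStage, π]

end Tree

section Optimum

variable {S A : Type} {H : ℕ} [Fintype S] [Finite A]

theorem optValue_leafMDP {s₁ : S} {next : Fin H → S → A → S} {h₀ : Fin H}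
    (hsurj : Function.Surjective (leafOf s₁ next h₀)) (f : S × A → ℝ) {c : S × A}
    (hc : ∀ c', f c' ≤ f c) : (leafMDP s₁ next h₀ f).optValue = f c := by
  obtain ⟨π, hπ⟩ := hsurj c
  have : Nonempty (Policy S A H) := ⟨π⟩
  refine le_antisymm (ciSup_le fun π' => ?_) ?_
  · rw [value_leafMDP]
    exact hc _
  · have := le_ciSup (f := fun π => (leafMDP s₁ next h₀ f).value π) (Set.finite_range _).bddAbove π
    rwa [value_leafMDP, hπ] at this

omit [Fintype S] [Finite A] in
theorem ofDet_mem_gaussianDeterministic (s₁ : S) (next : Fin H → S → A → S)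
    (m : Fin H → S → A → ℝ) : MDP.ofDet s₁ next m ∈ MDP.gaussianDeterministic S A H :=
  ⟨fun h s a => ⟨next h s a, rfl⟩, fun h s a => ⟨m h s a, rfl⟩⟩

end Optimum

/-! ### An information inequality -/

section Information

/-- The information inequality behind lower bounds on sample complexities: a likelihood ratio
`exp Y` that gives mass at most `δ` to `E` satisfies `E[Y] ≤ P(E) log δ + log 2`. -/
theorem integral_log_likelihood_le {Ω : Type*} [MeasurableSpace Ω] {μ : Measure Ω}
    [IsProbabilityMeasure μ] {Y : Ω → ℝ} (hY : Integrable Y μ)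
    (hexp : ∫⁻ ω, ENNReal.ofReal (Real.exp (Y ω)) ∂μ ≤ 1) {E : Set Ω} (hE : MeasurableSet E)
    {δ : ℝ} (hδ : 0 < δ) (hEδ : ∫⁻ ω in E, ENNReal.ofReal (Real.exp (Y ω)) ∂μ ≤ ENNReal.ofReal δ) :
    ∫ ω, Y ω ∂μ ≤ μ.real E * Real.log δ + Real.log 2 := by
  have hint : Integrable (fun ω => Real.exp (Y ω)) μ := by
    refine ⟨Real.continuous_exp.comp_aestronglyMeasurable hY.1, ?_⟩
    rw [hasFiniteIntegral_iff_ofReal (ae_of_all _ fun ω => (Real.exp_pos _).le)]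
    exact hexp.trans_lt ENNReal.one_lt_top
  have h1 : ∫ ω, Real.exp (Y ω) ∂μ ≤ 1 := by
    rw [integral_eq_lintegral_of_nonneg_ae (ae_of_all _ fun ω => (Real.exp_pos _).le) hint.1]
    exact ENNReal.toReal_le_of_le_ofReal zero_le_one (by simpa using hexp)
  have h2 : ∫ ω in E, Real.exp (Y ω) ∂μ ≤ δ := by
    rw [integral_eq_lintegral_of_nonneg_ae (ae_of_all _ fun ω => (Real.exp_pos _).le)
      hint.1.restrict]
    exact ENNReal.toReal_le_of_le_ofReal hδ.le hEδ
  have h3 : ∫ ω in Eᶜ, Real.exp (Y ω) ∂μ ≤ 1 :=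
    (setIntegral_le_integral hint (ae_of_all _ fun ω => (Real.exp_pos _).le)).trans h1
  -- The graph of `exp` lies above its tangent at `log k`. With `k = 2δ` on `E` and `k = 2` off `E`,
  -- each likelihood term is at most `1/2`, and together they cancel the `-1`.
  have tangent : ∀ k : ℝ, 0 < k → ∀ y : ℝ, y ≤ k⁻¹ * Real.exp y + (Real.log k - 1) := by
    intro k hk y
    have h := Real.add_one_le_exp (y - Real.log k)
    rw [Real.exp_sub, Real.exp_log hk, div_eq_inv_mul] at h
    linarith
  have hon : ∀ (k : ℝ), 0 < k → ∀ B : Set Ω, ∫ ω in B, Y ω ∂μ ≤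
      k⁻¹ * ∫ ω in B, Real.exp (Y ω) ∂μ + μ.real B * (Real.log k - 1) := by
    intro k hk B
    have hi : IntegrableOn (fun ω => k⁻¹ * Real.exp (Y ω) + (Real.log k - 1)) B μ :=
      ((hint.const_mul _).add (integrable_const _)).integrableOn
    refine (integral_mono hY.integrableOn hi fun ω => tangent k hk (Y ω)).trans ?_
    rw [integral_add (hint.const_mul _).integrableOn (integrable_const _), integral_const_mul]
    simp
  rw [← integral_add_compl hE hY]
  have a1 := hon (2 * δ) (by positivity) E
  have a2 := hon 2 two_pos Eᶜ
  have hc : μ.real Eᶜ = 1 - μ.real E := by rw [measureReal_compl hE]; simp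
  rw [hc] at a2
  rw [Real.log_mul two_ne_zero hδ.ne'] at a1
  have b1 : (2 * δ)⁻¹ * ∫ ω in E, Real.exp (Y ω) ∂μ ≤ 1 / 2 := by
    rw [inv_mul_le_iff₀ (by positivity)]
    linarith
  nlinarith

end Information

/-! ### Stopping times -/

namespace PACAlgorithm

variable {U : Type*} {S A : Type} {H : ℕ} [MeasurableSpace U]
  [MeasurableSpace S] [MeasurableSpace A]

instance (alg : PACAlgorithm U S A H) : IsProbabilityMeasure alg.seedLaw := alg.seed_prob

/-- The algorithm has not stopped after `i` episodes or earlier. -/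
def running (alg : PACAlgorithm U S A H) (i : ℕ) : Set (U × History S A H i) :=
  {x | ∀ (j : ℕ) (hj : j ≤ i), (x.1, fun k => x.2 (Fin.castLE hj k)) ∉ alg.stopSet j}

/-- The algorithm stops after exactly `t` episodes. -/
def stopsAt (alg : PACAlgorithm U S A H) (t : ℕ) : Set (U × History S A H t) :=
  {x | x ∈ alg.stopSet t ∧
    ∀ (j : ℕ) (hj : j < t), (x.1, fun k => x.2 (Fin.castLE hj.le k)) ∉ alg.stopSet j}

theorem measurableSet_running (alg : PACAlgorithm U S A H) (i : ℕ) :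
    MeasurableSet (alg.running i) := by
  have : alg.running i = ⋂ (j : ℕ) (hj : j ≤ i),
      (fun x : U × History S A H i => (x.1, fun k => x.2 (Fin.castLE hj k))) ⁻¹'
        (alg.stopSet j)ᶜ := by
    ext x; simp [running]
  rw [this]
  refine MeasurableSet.iInter fun j => MeasurableSet.iInter fun hj => ?_
  have hm : Measurable fun x : U × History S A H i =>
      ((x.1, fun k => x.2 (Fin.castLE hj k)) : U × History S A H j) := by fun_prop
  exact hm (alg.measurable_stopSet j).compl

theorem measurableSet_stopsAt (alg : PACAlgorithm U S A H) (t : ℕ) :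
    MeasurableSet (alg.stopsAt t) := by
  have : alg.stopsAt t = alg.stopSet t ∩ ⋂ (j : ℕ) (hj : j < t),
      (fun x : U × History S A H t => (x.1, fun k => x.2 (Fin.castLE hj.le k))) ⁻¹'
        (alg.stopSet j)ᶜ := by
    ext x; simp [stopsAt]
  rw [this]
  refine (alg.measurable_stopSet t).inter
    (MeasurableSet.iInter fun j => MeasurableSet.iInter fun hj => ?_)
  have hm : Measurable fun x : U × History S A H t =>
      ((x.1, fun k => x.2 (Fin.castLE hj.le k)) : U × History S A H j) := by fun_prop
  exact hm (alg.measurable_stopSet j).compl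

variable (alg : PACAlgorithm U S A H) (M : MDP S A H) (ω : U × Noise S A H)

theorem mem_running_history (i : ℕ) : (ω.1, M.history alg.sample i ω) ∈ alg.running i ↔
    ∀ j ≤ i, (ω.1, M.history alg.sample j ω) ∉ alg.stopSet j :=
  Iff.rfl

theorem mem_stopsAt_history (t : ℕ) : (ω.1, M.history alg.sample t ω) ∈ alg.stopsAt t ↔
    (ω.1, M.history alg.sample t ω) ∈ alg.stopSet t ∧
    ∀ j < t, (ω.1, M.history alg.sample j ω) ∉ alg.stopSet j :=
  Iff.rfl

theorem tau_eq_iff (t : ℕ) :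
    alg.tau M ω = t ↔ (ω.1, M.history alg.sample t ω) ∈ alg.stopsAt t := by
  rw [mem_stopsAt_history]
  unfold tau
  constructor
  · intro h
    have hlt : ∀ j < t, (ω.1, M.history alg.sample j ω) ∉ alg.stopSet j := by
      intro j hj hmem
      have := iInf₂_le (f := fun (t : ℕ)
        (_ : (ω.1, M.history alg.sample t ω) ∈ alg.stopSet t) => (t : ℕ∞)) j hmem
      rw [h] at this
      have := Nat.cast_le.1 this
      omega
    refine ⟨?_, hlt⟩
    by_contra hn
    have : ((t + 1 : ℕ) : ℕ∞) ≤ ⨅ (t : ℕ)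
        (_ : (ω.1, M.history alg.sample t ω) ∈ alg.stopSet t), (t : ℕ∞) := by
      refine le_iInf₂ fun j hj => Nat.cast_le.2 ?_
      by_contra hc
      rcases Nat.lt_or_ge j t with h1 | h1
      · exact hlt j h1 hj
      · have : j = t := by omega
        subst this
        exact hn hj
    rw [h] at this
    have := Nat.cast_le.1 this
    omega
  · rintro ⟨h1, h2⟩
    refine le_antisymm (iInf₂_le (f := fun (t : ℕ)
        (_ : (ω.1, M.history alg.sample t ω) ∈ alg.stopSet t) => (t : ℕ∞)) t h1) ?_
    refine le_iInf₂ fun j hj => Nat.cast_le.2 ?_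
    by_contra hc
    exact h2 j (by omega) hj

theorem running_iff_of_stopsAt {t : ℕ} (ht : (ω.1, M.history alg.sample t ω) ∈ alg.stopsAt t)
    (i : ℕ) : (ω.1, M.history alg.sample i ω) ∈ alg.running i ↔ i < t := by
  rw [mem_stopsAt_history] at ht
  rw [mem_running_history]
  constructor
  · intro h
    by_contra hc
    exact h t (by omega) ht.1
  · intro h j hj
    exact ht.2 j (by omega)

theorem stopsAt_unique {t t' : ℕ} (ht : (ω.1, M.history alg.sample t ω) ∈ alg.stopsAt t)
    (ht' : (ω.1, M.history alg.sample t' ω) ∈ alg.stopsAt t') : t = t' := by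
  rw [← tau_eq_iff] at ht ht'
  rw [ht] at ht'
  exact Nat.cast_injective ht'

open Classical in
theorem sum_running_le_tau (n : ℕ) :
    (∑ i ∈ Finset.range n,
      if (ω.1, M.history alg.sample i ω) ∈ alg.running i then (1 : ℝ≥0∞) else 0) ≤
      (alg.tau M ω : ℝ≥0∞) := by
  cases h : alg.tau M ω using ENat.recTopCoe with
  | top => simp
  | coe t =>
    rw [tau_eq_iff] at h
    simp_rw [running_iff_of_stopsAt alg M ω h]
    rw [← Finset.sum_filter]
    simp only [Finset.sum_const, nsmul_eq_mul, mul_one]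
    have : (Finset.filter (fun i => i < t) (Finset.range n)) ⊆ Finset.range t := by
      intro i; simp
    have := Finset.card_le_card this
    rw [Finset.card_range] at this
    exact_mod_cast this

end PACAlgorithm

/-! ### The gated likelihood ratio as an exponential -/

section Gated

variable {U : Type*} {S A : Type} {H : ℕ} [DecidableEq S] [DecidableEq A]

open Classical in
theorem gatedTilt_history (M : MDP S A H) (alg : SamplingRule U S A H)
    (g : (i : ℕ) → Set (U × History S A H i)) (h₀ : Fin H) (c : S × A) (m l : ℝ) (n : ℕ)
    (ω : U × Noise S A H) :
    gatedTilt g h₀ c m l n (ω.1, M.history alg n ω) =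
      ∏ i ∈ Finset.range n, if (ω.1, M.history alg i ω) ∈ g i then
        leafTilt h₀ c m l (M.episode alg ω i) else 1 := by
  rw [← Fin.prod_univ_eq_prod_range (fun i => if (ω.1, M.history alg i ω) ∈ g i then
        leafTilt h₀ c m l (M.episode alg ω i) else 1) n]
  rfl

open Classical in
/-- Whether `c` is visited in episode `i` while the gate is open, as a real number. -/
noncomputable def gatedVisit (g : (i : ℕ) → Set (U × History S A H i)) (h₀ : Fin H) (c : S × A)
    (i : ℕ) (p : (U × History S A H i) × Episode S A H) : ℝ :=
  if p.1 ∈ g i ∧ leafPair h₀ p.2 = c then 1 else 0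

theorem gatedVisit_nonneg (g : (i : ℕ) → Set (U × History S A H i)) (h₀ : Fin H) (c : S × A)
    (i : ℕ) (p : (U × History S A H i) × Episode S A H) : 0 ≤ gatedVisit g h₀ c i p := by
  unfold gatedVisit; split_ifs <;> norm_num

theorem gatedVisit_le_one (g : (i : ℕ) → Set (U × History S A H i)) (h₀ : Fin H) (c : S × A)
    (i : ℕ) (p : (U × History S A H i) × Episode S A H) : gatedVisit g h₀ c i p ≤ 1 := by
  unfold gatedVisit; split_ifs <;> norm_num

theorem gatedTilt_eq_ofReal_exp (M : MDP S A H) (alg : SamplingRule U S A H)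
    (g : (i : ℕ) → Set (U × History S A H i)) (h₀ : Fin H) (c : S × A) (m l : ℝ) (n : ℕ)
    (ω : U × Noise S A H) :
    gatedTilt g h₀ c m l n (ω.1, M.history alg n ω) =
      ENNReal.ofReal (Real.exp (∑ i ∈ Finset.range n,
        (l * gatedReward g h₀ c m i ((ω.1, M.history alg i ω), M.episode alg ω i) -
          l ^ 2 / 2 * gatedVisit g h₀ c i ((ω.1, M.history alg i ω), M.episode alg ω i)))) := by
  classical
  rw [gatedTilt_history, Real.exp_sum, ENNReal.ofReal_prod_of_nonneg fun _ _ => (Real.exp_pos _).le]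
  refine Finset.prod_congr rfl fun i _ => ?_
  simp only [gatedReward, gatedVisit, leafTilt]
  by_cases h1 : (ω.1, M.history alg i ω) ∈ g i <;>
    by_cases h2 : leafPair h₀ (M.episode alg ω i) = c <;> simp [h1, h2]

variable [MeasurableSpace U]
  [MeasurableSpace S] [MeasurableSingletonClass S] [MeasurableSpace A] [MeasurableSingletonClass A]

theorem measurable_gatedVisit {g : (i : ℕ) → Set (U × History S A H i)}
    (hg : ∀ i, MeasurableSet (g i)) (h₀ : Fin H) (c : S × A) (i : ℕ) :
    Measurable (gatedVisit g h₀ c i) :=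
  Measurable.ite ((measurable_fst (hg i)).inter
      (((measurable_leafPair h₀).comp measurable_snd) (measurableSet_singleton c)))
    measurable_const measurable_const

theorem integrable_gatedVisit [Finite S] [Finite A] (M : MDP S A H) (ν : Measure U)
    [IsProbabilityMeasure ν] {alg : SamplingRule U S A H} (halg : alg.IsMeasurable)
    {g : (i : ℕ) → Set (U × History S A H i)}
    (hg : ∀ i, MeasurableSet (g i)) (h₀ : Fin H) (c : S × A) (i : ℕ) :
    Integrable (fun ω => gatedVisit g h₀ c i ((ω.1, M.history alg i ω), M.episode alg ω i))
      (M.law ν) := by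
  refine Integrable.of_bound (C := 1) ?_ (ae_of_all _ fun ω => ?_)
  · exact ((measurable_gatedVisit hg h₀ c i).comp
      ((measurable_fst.prodMk (M.measurable_history halg i)).prodMk
        (M.measurable_episode halg i))).aestronglyMeasurable
  · rw [Real.norm_of_nonneg (gatedVisit_nonneg _ _ _ _ _)]
    exact gatedVisit_le_one _ _ _ _ _

end Gated

/-! ### Wald's identity and the number of visits that a decision needs -/

namespace PACAlgorithm

variable {U : Type*} {S A : Type} {H : ℕ} [MeasurableSpace U]
  [MeasurableSpace S] [MeasurableSpace A]

/-- The algorithm stops after at most `n` episodes, with seed and history in `B`. -/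
def stopEvent (alg : PACAlgorithm U S A H) (M : MDP S A H)
    (B : (t : ℕ) → Set (U × History S A H t)) (n : ℕ) : Set (U × Noise S A H) :=
  ⋃ t ∈ Finset.range (n + 1), {ω | (ω.1, M.history alg.sample t ω) ∈ alg.stopsAt t ∩ B t}

variable [Finite S] [MeasurableSingletonClass S] [Finite A] [MeasurableSingletonClass A]

theorem measurableSet_stopsAt_history (alg : PACAlgorithm U S A H) (M : MDP S A H)
    {B : (t : ℕ) → Set (U × History S A H t)} (hB : ∀ t, MeasurableSet (B t)) (t : ℕ) :
    MeasurableSet {ω | (ω.1, M.history alg.sample t ω) ∈ alg.stopsAt t ∩ B t} :=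
  (measurable_fst.prodMk (M.measurable_history alg.measurable_sample t))
    ((alg.measurableSet_stopsAt t).inter (hB t))

theorem measurableSet_stopEvent (alg : PACAlgorithm U S A H) (M : MDP S A H)
    {B : (t : ℕ) → Set (U × History S A H t)} (hB : ∀ t, MeasurableSet (B t)) (n : ℕ) :
    MeasurableSet (alg.stopEvent M B n) :=
  Finset.measurableSet_biUnion _ fun t _ => alg.measurableSet_stopsAt_history M hB t

omit [Finite S] [MeasurableSingletonClass S] [Finite A] [MeasurableSingletonClass A] in
theorem pairwiseDisjoint_stopsAt (alg : PACAlgorithm U S A H) (M : MDP S A H)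
    (B : (t : ℕ) → Set (U × History S A H t)) (s : Set ℕ) :
    s.PairwiseDisjoint fun t => {ω | (ω.1, M.history alg.sample t ω) ∈ alg.stopsAt t ∩ B t} := by
  intro t _ t' _ htt
  rw [Function.onFun, Set.disjoint_left]
  intro ω h h'
  exact htt (alg.stopsAt_unique M ω h.1 h'.1)

variable [DecidableEq S] [DecidableEq A]

-- The gate closes when the algorithm stops, and later factors are one. A single horizon `n` thus
-- serves all stopping times `t ≤ n`.
omit [Finite S] [MeasurableSingletonClass S] [Finite A] [MeasurableSingletonClass A] in
theorem gatedTilt_of_stopsAt (alg : PACAlgorithm U S A H) (M : MDP S A H) (h₀ : Fin H) (c : S × A)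
    (m l : ℝ) {t n : ℕ} (htn : t ≤ n) {ω : U × Noise S A H}
    (ht : (ω.1, M.history alg.sample t ω) ∈ alg.stopsAt t) :
    gatedTilt alg.running h₀ c m l n (ω.1, M.history alg.sample n ω) =
      histTilt h₀ c m l (M.history alg.sample t ω) := by
  classical
  rw [gatedTilt_history]
  simp_rw [alg.running_iff_of_stopsAt M ω ht]
  have : histTilt h₀ c m l (M.history alg.sample t ω) =
      ∏ i ∈ Finset.range t, leafTilt h₀ c m l (M.episode alg.sample ω i) := by
    rw [← Fin.prod_univ_eq_prod_range (fun i => leafTilt h₀ c m l (M.episode alg.sample ω i)) t]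
    rfl
  rw [this, ← Finset.prod_filter]
  congr 1
  ext i
  simp only [Finset.mem_filter, Finset.mem_range]
  omega

/-- Wald's likelihood ratio identity, for the event of stopping early with history in `B`. -/
theorem law_stopEvent_update (alg : PACAlgorithm U S A H) (s₁ : S) (next : Fin H → S → A → S)
    (h₀ : Fin H) (f : S × A → ℝ) (c : S × A) (l : ℝ)
    {B : (t : ℕ) → Set (U × History S A H t)} (hB : ∀ t, MeasurableSet (B t)) (n : ℕ) :
    (leafMDP s₁ next h₀ (Function.update f c (f c + l))).law alg.seedLaw
        (alg.stopEvent (leafMDP s₁ next h₀ (Function.update f c (f c + l))) B n) =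
      ∫⁻ ω in alg.stopEvent (leafMDP s₁ next h₀ f) B n, gatedTilt alg.running h₀ c (f c) l n
          (ω.1, (leafMDP s₁ next h₀ f).history alg.sample n ω)
        ∂((leafMDP s₁ next h₀ f).law alg.seedLaw) := by
  unfold stopEvent
  rw [measure_biUnion_finset (alg.pairwiseDisjoint_stopsAt _ B _)
      (fun t _ => alg.measurableSet_stopsAt_history _ hB t),
    lintegral_biUnion_finset (alg.pairwiseDisjoint_stopsAt _ B _)
      (fun t _ => alg.measurableSet_stopsAt_history _ hB t)]
  refine Finset.sum_congr rfl fun t ht => ?_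
  have htn : t ≤ n := Nat.lt_succ_iff.1 (Finset.mem_range.1 ht)
  have hC : MeasurableSet (alg.stopsAt t ∩ B t) := (alg.measurableSet_stopsAt t).inter (hB t)
  -- Stopping at exactly `t` with history in `B t` is decided by the seed and the first `t`
  -- episodes, so the change of measure at the fixed time `t` applies.
  have e := lintegral_history_update s₁ next h₀ f c l alg.seedLaw alg.measurable_sample t
    (F := (alg.stopsAt t ∩ B t).indicator 1) (measurable_one.indicator hC)
  rw [← lintegral_indicator_one (alg.measurableSet_stopsAt_history _ hB t),
    ← lintegral_indicator (alg.measurableSet_stopsAt_history _ hB t)]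
  refine Eq.trans ?_ (e.trans ?_)
  · rfl
  · refine lintegral_congr fun ω => ?_
    by_cases h : (ω.1, (leafMDP s₁ next h₀ f).history alg.sample t ω) ∈ alg.stopsAt t ∩ B t
    · rw [Set.indicator_of_mem h, Set.indicator_of_mem (by exact h),
        alg.gatedTilt_of_stopsAt _ h₀ c (f c) l htn h.1]
      simp
    · rw [Set.indicator_of_notMem h, Set.indicator_of_notMem (by exact h), zero_mul]

/-- A pair has to be visited often before an event can be decided that is unlikely as soon as
the mean reward of this pair is changed by `l`. -/
theorem le_integral_gatedVisit (alg : PACAlgorithm U S A H) (s₁ : S) (next : Fin H → S → A → S)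
    (h₀ : Fin H) (f : S × A → ℝ) (c : S × A) (l : ℝ)
    {B : (t : ℕ) → Set (U × History S A H t)} (hB : ∀ t, MeasurableSet (B t)) (n : ℕ)
    {δ : ℝ} (hδ : 0 < δ)
    (h : (leafMDP s₁ next h₀ (Function.update f c (f c + l))).law alg.seedLaw
        (alg.stopEvent (leafMDP s₁ next h₀ (Function.update f c (f c + l))) B n) ≤
      ENNReal.ofReal δ) :
    ((leafMDP s₁ next h₀ f).law alg.seedLaw).real (alg.stopEvent (leafMDP s₁ next h₀ f) B n) *
        Real.log (1 / δ) - Real.log 2 ≤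
      l ^ 2 / 2 * ∑ i ∈ Finset.range n, ∫ ω, gatedVisit alg.running h₀ c i
          ((ω.1, (leafMDP s₁ next h₀ f).history alg.sample i ω),
            (leafMDP s₁ next h₀ f).episode alg.sample ω i)
        ∂((leafMDP s₁ next h₀ f).law alg.seedLaw) := by
  set M := leafMDP s₁ next h₀ f with hM
  have hrun := alg.measurableSet_running
  have hr := fun i => integral_gatedReward s₁ next h₀ f c alg.seedLaw alg.measurable_sample hrun i
  have hv := fun i => integrable_gatedVisit M alg.seedLaw alg.measurable_sample hrun h₀ c i
  rw [← hM] at hr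
  have hYi : ∀ i ∈ Finset.range n, Integrable (fun ω => l * gatedReward alg.running h₀ c (f c) i
          ((ω.1, M.history alg.sample i ω), M.episode alg.sample ω i) -
        l ^ 2 / 2 * gatedVisit alg.running h₀ c i
          ((ω.1, M.history alg.sample i ω), M.episode alg.sample ω i)) (M.law alg.seedLaw) :=
    fun i _ => ((hr i).1.const_mul _).sub ((hv i).const_mul _)
  have hY := integrable_finsetSum _ hYi
  have h1 := lintegral_gatedTilt s₁ next h₀ f c l alg.seedLaw alg.measurable_sample hrun n
  have h2 := law_stopEvent_update alg s₁ next h₀ f c l hB n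
  rw [h2] at h
  rw [← hM] at h h1
  simp_rw [gatedTilt_eq_ofReal_exp] at h h1
  have key := integral_log_likelihood_le hY h1.le (alg.measurableSet_stopEvent M hB n) hδ h
  rw [integral_finsetSum _ hYi] at key
  -- The centered reward has mean zero, so that the log-likelihood ratio loses `l ^ 2 / 2` per
  -- expected visit.
  have e : ∀ i ∈ Finset.range n, ∫ ω, (l * gatedReward alg.running h₀ c (f c) i
          ((ω.1, M.history alg.sample i ω), M.episode alg.sample ω i) -
        l ^ 2 / 2 * gatedVisit alg.running h₀ c i
          ((ω.1, M.history alg.sample i ω), M.episode alg.sample ω i)) ∂(M.law alg.seedLaw) =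
      - (l ^ 2 / 2 * ∫ ω, gatedVisit alg.running h₀ c i
          ((ω.1, M.history alg.sample i ω), M.episode alg.sample ω i) ∂(M.law alg.seedLaw)) := by
    intro i _
    rw [integral_sub ((hr i).1.const_mul _) ((hv i).const_mul _), integral_const_mul,
      integral_const_mul, (hr i).2]
    ring
  rw [Finset.sum_congr rfl e, Finset.sum_neg_distrib, ← Finset.mul_sum] at key
  rw [one_div, Real.log_inv]
  linarith

end PACAlgorithm

/-! ### Consequences of the PAC property -/

namespace PACAlgorithm

variable {U : Type*} {S A : Type} {H : ℕ} [MeasurableSpace U]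
  [MeasurableSpace S] [MeasurableSpace A] [Fintype S] [MeasurableSingletonClass S]
  [Fintype A] [MeasurableSingletonClass A] [DecidableEq S] [DecidableEq A]

/-- The recommended policy visits `c` at stage `h₀`. -/
def recommends (alg : PACAlgorithm U S A H) (s₁ : S) (next : Fin H → S → A → S) (h₀ : Fin H)
    (c : S × A) (t : ℕ) : Set (U × History S A H t) :=
  {x | leafOf s₁ next h₀ (alg.recommend t x) = c}

omit [MeasurableSingletonClass S] [DecidableEq S] [DecidableEq A] in
theorem measurableSet_recommends (alg : PACAlgorithm U S A H) (s₁ : S) (next : Fin H → S → A → S)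
    (h₀ : Fin H) (c : S × A) (t : ℕ) : MeasurableSet (alg.recommends s₁ next h₀ c t) :=
  alg.measurable_recommend t (Set.to_countable {π | leafOf s₁ next h₀ π = c}).measurableSet

omit [DecidableEq S] [DecidableEq A] in
theorem law_stopEvent_le_of_success_subset (alg : PACAlgorithm U S A H) {M : MDP S A H} {ε δ : ℝ}
    (hPAC : alg.IsPAC (MDP.gaussianDeterministic S A H) ε δ)
    (hM : M ∈ MDP.gaussianDeterministic S A H) {B : (t : ℕ) → Set (U × History S A H t)}
    (hB : ∀ t, MeasurableSet (B t)) (n : ℕ) (h : alg.success M ε ⊆ (alg.stopEvent M B n)ᶜ) :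
    M.law alg.seedLaw (alg.stopEvent M B n) ≤ ENNReal.ofReal δ := by
  have h1 := (hPAC M hM).trans (measure_mono h)
  rw [prob_compl_eq_one_sub (alg.measurableSet_stopEvent M hB n)] at h1
  have h2 : M.law alg.seedLaw (alg.stopEvent M B n) ≤ 1 := prob_le_one
  have h3 : M.law alg.seedLaw (alg.stopEvent M B n) + ENNReal.ofReal (1 - δ) ≤ 1 := by
    refine (add_le_add le_rfl h1).trans ?_
    rw [add_tsub_cancel_of_le h2]
  have h4 : (1 : ℝ≥0∞) ≤ ENNReal.ofReal δ + ENNReal.ofReal (1 - δ) := by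
    rw [← ENNReal.ofReal_one]
    refine le_trans (ENNReal.ofReal_le_ofReal ?_) ENNReal.ofReal_add_le
    linarith
  exact (ENNReal.add_le_add_iff_right ENNReal.ofReal_ne_top).1 (h3.trans h4)

-- Success includes stopping, and the events of having stopped by time `n` increase to that of
-- stopping at all. The finite horizon keeps the log-likelihood ratio integrable without assuming
-- that `τ` is.
omit [MeasurableSingletonClass S] [Fintype A] [MeasurableSingletonClass A] [DecidableEq S]
  [DecidableEq A] in
theorem exists_stopEvent_ge (alg : PACAlgorithm U S A H) {M : MDP S A H} {ε δ r : ℝ}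
    (hr : r < 1 - δ) (hr0 : 0 ≤ r) (hPAC : alg.IsPAC (MDP.gaussianDeterministic S A H) ε δ)
    (hM : M ∈ MDP.gaussianDeterministic S A H) :
    ∃ n, r ≤ (M.law alg.seedLaw).real (alg.stopEvent M (fun _ => Set.univ) n) := by
  have hmono : Monotone fun n => alg.stopEvent M (fun _ => Set.univ) n := by
    intro n n' hn
    exact Set.biUnion_subset_biUnion_left (by
      intro t ht
      simp only [Finset.coe_range, Set.mem_Iio] at ht ⊢
      omega)
  have hsub : alg.success M ε ⊆ ⋃ n, alg.stopEvent M (fun _ => Set.univ) n := by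
    rintro ω ⟨t, ht, -⟩
    rw [tau_eq_iff] at ht
    refine Set.mem_iUnion.2 ⟨t, Set.mem_biUnion (x := t) ?_ ?_⟩
    · simp
    · exact ⟨ht, trivial⟩
  have h1 := (hPAC M hM).trans (measure_mono hsub)
  rw [hmono.measure_iUnion] at h1
  have h2 : ENNReal.ofReal r < ENNReal.ofReal (1 - δ) :=
    (ENNReal.ofReal_lt_ofReal_iff (hr0.trans_lt hr)).2 hr
  obtain ⟨n, hn⟩ := lt_iSup_iff.1 (h2.trans_le h1)
  exact ⟨n, (ENNReal.ofReal_le_iff_le_toReal (measure_ne_top _ _)).1 hn.le⟩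

-- A run stops at most once and the policy returned then visits a single pair at stage `h₀`, so
-- these events are disjoint.
omit [DecidableEq S] [DecidableEq A] in
theorem sum_law_stopEvent_recommends_le (alg : PACAlgorithm U S A H) (M : MDP S A H) (s₁ : S)
    (next : Fin H → S → A → S) (h₀ : Fin H) (n : ℕ) (C : Finset (S × A)) :
    ∑ c ∈ C, (M.law alg.seedLaw).real (alg.stopEvent M (alg.recommends s₁ next h₀ c) n) ≤ 1 := by
  rw [← measureReal_biUnion_finset]
  · exact measureReal_le_one
  · intro c _ c' _ hcc
    rw [Function.onFun, Set.disjoint_left]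
    intro ω h h'
    simp only [stopEvent, Set.mem_iUnion] at h h'
    obtain ⟨t, -, ht⟩ := h
    obtain ⟨t', -, ht'⟩ := h'
    obtain rfl := alg.stopsAt_unique M ω ht.1 ht'.1
    exact hcc (ht.2.symm.trans ht'.2)
  · exact fun c _ => alg.measurableSet_stopEvent M (alg.measurableSet_recommends s₁ next h₀ c) n

omit [MeasurableSpace U] [MeasurableSpace S] [MeasurableSpace A] [Fintype S]
  [MeasurableSingletonClass S] [Fintype A] [MeasurableSingletonClass A] in
theorem sum_gatedVisit_le (g : (i : ℕ) → Set (U × History S A H i)) (h₀ : Fin H)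
    (C : Finset (S × A)) (i : ℕ) (p : (U × History S A H i) × Episode S A H)
    [Decidable (p.1 ∈ g i)] :
    ENNReal.ofReal (∑ c ∈ C, gatedVisit g h₀ c i p) ≤ if p.1 ∈ g i then 1 else 0 := by
  classical
  by_cases h : p.1 ∈ g i
  · rw [if_pos h, ← ENNReal.ofReal_one]
    refine ENNReal.ofReal_le_ofReal ?_
    simp only [gatedVisit, h, true_and]
    rw [Finset.sum_ite_eq C (leafPair h₀ p.2) (fun _ => (1 : ℝ))]
    split_ifs <;> norm_num
  · simp [gatedVisit, h]

/-- An episode visits one pair at stage `h₀`, so summing over pairs counts each episode that is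
actually played at most once. -/
theorem sum_integral_gatedVisit_le_expectedTau (alg : PACAlgorithm U S A H) (M : MDP S A H)
    (h₀ : Fin H) (C : Finset (S × A)) (n : ℕ) :
    ENNReal.ofReal (∑ c ∈ C, ∑ i ∈ Finset.range n, ∫ ω, gatedVisit alg.running h₀ c i
      ((ω.1, M.history alg.sample i ω), M.episode alg.sample ω i) ∂(M.law alg.seedLaw)) ≤
      alg.expectedTau M := by
  classical
  have hv := fun c i => integrable_gatedVisit M alg.seedLaw alg.measurable_sample
    alg.measurableSet_running h₀ c i
  rw [Finset.sum_comm]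
  have e : ∑ i ∈ Finset.range n, ∑ c ∈ C, ∫ ω, gatedVisit alg.running h₀ c i
      ((ω.1, M.history alg.sample i ω), M.episode alg.sample ω i) ∂(M.law alg.seedLaw) =
      ∫ ω, ∑ i ∈ Finset.range n, ∑ c ∈ C, gatedVisit alg.running h₀ c i
      ((ω.1, M.history alg.sample i ω), M.episode alg.sample ω i) ∂(M.law alg.seedLaw) := by
    rw [integral_finsetSum _ fun i _ => integrable_finsetSum _ fun c _ => hv c i]
    refine Finset.sum_congr rfl fun i _ => ?_
    rw [integral_finsetSum _ fun c _ => hv c i]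
  rw [e, ofReal_integral_eq_lintegral_ofReal
    (integrable_finsetSum _ fun i _ => integrable_finsetSum _ fun c _ => hv c i)
    (ae_of_all _ fun ω => Finset.sum_nonneg fun i _ => Finset.sum_nonneg fun c _ =>
      gatedVisit_nonneg _ _ _ _ _)]
  refine lintegral_mono fun ω => ?_
  rw [ENNReal.ofReal_sum_of_nonneg fun i _ => Finset.sum_nonneg fun c _ =>
      gatedVisit_nonneg _ _ _ _ _]
  exact (Finset.sum_le_sum fun i _ => sum_gatedVisit_le alg.running h₀ C i
    ((ω.1, M.history alg.sample i ω), M.episode alg.sample ω i)).trans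
      (alg.sum_running_le_tau M ω n)

end PACAlgorithm

/-! ### The lower bound for identification -/

section LowerBound

variable {S A : Type} {H : ℕ} [DecidableEq S] [DecidableEq A]

/-- All pairs are equally good, except for `c₀`, which is worse by `ε`. -/
def oneBadLeaf (c₀ : S × A) (ε : ℝ) (c : S × A) : ℝ := if c = c₀ then -ε else 0

variable {U : Type*} [MeasurableSpace U]
  [MeasurableSpace S] [MeasurableSpace A] [Fintype S] [MeasurableSingletonClass S]
  [Fintype A] [MeasurableSingletonClass A]

theorem PACAlgorithm.expectedTau_oneBadLeaf_ge (alg : PACAlgorithm U S A H) {s₁ : S}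
    {next : Fin H → S → A → S} {h₀ : Fin H} (hsurj : Function.Surjective (leafOf s₁ next h₀))
    (c₀ : S × A) {ε δ : ℝ} (hε : 0 < ε) (hδ : 0 < δ)
    (hPAC : alg.IsPAC (MDP.gaussianDeterministic S A H) ε δ)
    (hcard : 8 ≤ Fintype.card S * Fintype.card A) :
    ENNReal.ofReal (Fintype.card S * Fintype.card A * Real.log (1 / (4 * δ)) / (16 * ε ^ 2)) ≤
      alg.expectedTau (leafMDP s₁ next h₀ (oneBadLeaf c₀ ε)) := by
  set M := leafMDP s₁ next h₀ (oneBadLeaf c₀ ε) with hM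
  set K : ℝ := Fintype.card S * Fintype.card A with hK
  have hK8 : 8 ≤ K := by
    rw [hK]; exact_mod_cast hcard
  have hlog4 : Real.log (1 / (4 * δ)) = Real.log (1 / δ) - 2 * Real.log 2 := by
    rw [one_div, one_div, Real.log_inv, Real.log_inv, Real.log_mul (by norm_num) hδ.ne',
      show (4 : ℝ) = 2 ^ 2 by norm_num, Real.log_pow]
    push_cast
    ring
  rcases le_or_gt (1 / 4) δ with hδ4 | hδ4
  · rw [ENNReal.ofReal_of_nonpos]
    · exact zero_le
    · refine div_nonpos_of_nonpos_of_nonneg ?_ (by positivity)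
      refine mul_nonpos_of_nonneg_of_nonpos (by linarith) (Real.log_nonpos (by positivity) ?_)
      rw [div_le_one (by positivity)]
      linarith
  have hL : 2 * Real.log 2 ≤ Real.log (1 / δ) := by
    have : 0 ≤ Real.log (1 / (4 * δ)) := by
      refine Real.log_nonneg ?_
      rw [le_div_iff₀ (by positivity)]
      linarith
    linarith
  have hMmem : M ∈ MDP.gaussianDeterministic S A H := ofDet_mem_gaussianDeterministic _ _ _
  -- The case `δ ≥ 1/4`, where the bound is not positive, is settled; now `3/4 < 1 - δ`.
  obtain ⟨n, hn⟩ := alg.exists_stopEvent_ge (r := 3 / 4) (by linarith) (by norm_num) hPAC hMmem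
  let C : Finset (S × A) := Finset.univ.erase c₀
  have hC : (C.card : ℝ) = K - 1 := by
    have : C.card + 1 = Fintype.card S * Fintype.card A := by
      rw [Finset.card_erase_add_one (Finset.mem_univ _), Finset.card_univ, Fintype.card_prod]
    have h2 : ((C.card + 1 : ℕ) : ℝ) = K := by rw [this, hK]; push_cast; rfl
    push_cast at h2
    linarith
  let B : S × A → (t : ℕ) → Set (U × History S A H t) := fun c t =>
    (alg.recommends s₁ next h₀ c t)ᶜ
  have hB : ∀ c t, MeasurableSet (B c t) := fun c t =>
    (alg.measurableSet_recommends s₁ next h₀ c t).compl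
  have hsingle : ∀ c ∈ C,
      (M.law alg.seedLaw).real (alg.stopEvent M (B c) n) * Real.log (1 / δ) - Real.log 2 ≤
      (2 * ε) ^ 2 / 2 * ∑ i ∈ Finset.range n, ∫ ω, gatedVisit alg.running h₀ c i
        ((ω.1, M.history alg.sample i ω), M.episode alg.sample ω i) ∂(M.law alg.seedLaw) := by
    intro c hc
    have hcc : c ≠ c₀ := Finset.ne_of_mem_erase hc
    have hfc : oneBadLeaf c₀ ε c = 0 := if_neg hcc
    -- The shift `2 * ε` makes every policy that misses `c` worse than optimal by at least `2 * ε`,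
    -- hence not `ε`-optimal.
    set f' := Function.update (oneBadLeaf c₀ ε) c (oneBadLeaf c₀ ε c + 2 * ε) with hf'
    have hf'c : f' c = 2 * ε := by rw [hf', Function.update_self, hfc, zero_add]
    have hf'ne : ∀ c' ≠ c, f' c' ≤ 0 := by
      intro c' h
      rw [hf', Function.update_of_ne h, oneBadLeaf]
      split_ifs <;> linarith
    refine alg.le_integral_gatedVisit s₁ next h₀ (oneBadLeaf c₀ ε) c (2 * ε) (hB c) n hδ ?_
    refine alg.law_stopEvent_le_of_success_subset hPAC (ofDet_mem_gaussianDeterministic _ _ _)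
      (hB c) n ?_
    rintro ω ⟨t, ht, hval⟩ hmem
    rw [optValue_leafMDP hsurj f' (c := c), value_leafMDP] at hval
    · simp only [PACAlgorithm.stopEvent, Set.mem_iUnion] at hmem
      obtain ⟨t', -, ht'⟩ := hmem
      rw [PACAlgorithm.tau_eq_iff] at ht
      obtain rfl := alg.stopsAt_unique _ ω ht ht'.1
      have := hf'ne _ ht'.2
      linarith
    · intro c'
      by_cases h : c' = c
      · rw [h]
      · exact (hf'ne c' h).trans (by linarith)
  have hsum := Finset.sum_le_sum hsingle
  rw [Finset.sum_sub_distrib, ← Finset.sum_mul, ← Finset.mul_sum, Finset.sum_const, nsmul_eq_mul,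
    hC] at hsum
  have hmass : (K - 1) * (3 / 4) - 1 ≤
      ∑ c ∈ C, (M.law alg.seedLaw).real (alg.stopEvent M (B c) n) := by
    have h1 := alg.sum_law_stopEvent_recommends_le M s₁ next h₀ n C
    have h2 : ∀ c ∈ C, 3 / 4 ≤ (M.law alg.seedLaw).real (alg.stopEvent M (B c) n) +
        (M.law alg.seedLaw).real (alg.stopEvent M (alg.recommends s₁ next h₀ c) n) := by
      intro c _
      refine hn.trans (le_trans (measureReal_mono ?_) (measureReal_union_le _ _))
      intro ω hω
      simp only [PACAlgorithm.stopEvent, Set.mem_iUnion, Set.mem_union] at hω ⊢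
      obtain ⟨t, ht, hω⟩ := hω
      by_cases hrec : (ω.1, M.history alg.sample t ω) ∈ alg.recommends s₁ next h₀ c t
      · exact Or.inr ⟨t, ht, hω.1, hrec⟩
      · exact Or.inl ⟨t, ht, hω.1, hrec⟩
    have h3 := Finset.sum_le_sum h2
    rw [Finset.sum_add_distrib, Finset.sum_const, nsmul_eq_mul, hC] at h3
    linarith
  refine le_trans (ENNReal.ofReal_le_ofReal ?_)
    (alg.sum_integral_gatedVisit_le_expectedTau M h₀ C n)
  rw [div_le_iff₀ (by positivity), hlog4]
  have hl2 : 0 < Real.log 2 := Real.log_pos one_lt_two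
  set T := ∑ c ∈ C, ∑ i ∈ Finset.range n, ∫ ω, gatedVisit alg.running h₀ c i
        ((ω.1, M.history alg.sample i ω), M.episode alg.sample ω i) ∂(M.law alg.seedLaw)
  have h5 := mul_le_mul_of_nonneg_right hmass (by linarith : 0 ≤ Real.log (1 / δ))
  have h6 : ((K - 1) * (3 / 4) - 1) * Real.log (1 / δ) - (K - 1) * Real.log 2 ≤ 2 * ε ^ 2 * T := by
    refine le_trans (by linarith) (hsum.trans (le_of_eq (by ring)))
  -- With `L = log (1/δ)`, eight times the left side of `h6` exceeds `K (L - 2 log 2)` by exactly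
  -- the sum of the quantities in `h7` and `h8`; both are nonnegative because `K ≥ 8`.
  have h7 : 0 ≤ (5 * K - 14) * (Real.log (1 / δ) - 2 * Real.log 2) :=
    mul_nonneg (by linarith) (by linarith)
  have h8 : 0 ≤ (4 * K - 20) * Real.log 2 := mul_nonneg (by linarith) hl2.le
  linarith

end LowerBound

/-! ### Measurability of UCBVI -/

section UCBMeasurability

variable {S A : Type} {H : ℕ} [DecidableEq S] [DecidableEq A]
  [MeasurableSpace S] [MeasurableSpace A] [MeasurableSingletonClass S] [MeasurableSingletonClass A]

omit [DecidableEq S] [DecidableEq A] in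
theorem measurableSet_visit {t : ℕ} (i : Fin t) (h : Fin H) (s : S) (a : A) :
    MeasurableSet {e : History S A H t | (e i h).1 = s ∧ (e i h).2.1 = a} := by
  have h1 : Measurable fun e : History S A H t => (e i h).1 := by fun_prop
  have h2 : Measurable fun e : History S A H t => (e i h).2.1 := by fun_prop
  exact (h1 (measurableSet_singleton s)).inter (h2 (measurableSet_singleton a))

theorem measurable_visits {t : ℕ} (h : Fin H) (s : S) (a : A) :
    Measurable fun e : History S A H t => visits e h s a := by
  unfold visits
  simp_rw [Finset.card_filter]
  exact Finset.measurable_sum _ fun i _ =>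
    Measurable.ite (measurableSet_visit i h s a) measurable_const measurable_const

theorem measurable_empReward {t : ℕ} (h : Fin H) (s : S) (a : A) :
    Measurable fun e : History S A H t => empReward e h s a := by
  unfold empReward
  refine Measurable.div (Finset.measurable_sum _ fun i _ => ?_) ?_
  · exact Measurable.ite (measurableSet_visit i h s a) (by fun_prop) measurable_const
  · exact (measurable_of_countable (fun n : ℕ => (n : ℝ))).comp (measurable_visits h s a)

theorem measurable_empTrans {t : ℕ} (h : Fin H) (s : S) (a : A) (s' : S) :
    Measurable fun e : History S A H t => empTrans e h s a s' := by
  unfold empTrans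
  refine Measurable.div ?_
    ((measurable_of_countable (fun n : ℕ => (n : ℝ))).comp (measurable_visits h s a))
  refine (measurable_of_countable (fun n : ℕ => (n : ℝ))).comp ?_
  simp_rw [Finset.card_filter]
  refine Finset.measurable_sum _ fun i _ => Measurable.ite ?_ measurable_const measurable_const
  refine (measurableSet_visit i h s a).inter ?_
  by_cases hh : (h : ℕ) + 1 < H
  · have h1 : Measurable fun e : History S A H t => (e i ⟨h + 1, hh⟩).1 := by fun_prop
    simp only [hh, exists_true_left]
    exact h1 (measurableSet_singleton s')
  · simp only [hh, IsEmpty.exists_iff]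
    exact MeasurableSet.empty

variable [Fintype S] [Fintype A]

theorem measurable_ucbQ (b : Fin H → ℕ → ℕ → ℝ≥0∞) {t : ℕ} (h : ℕ) (s : S) (a : A) :
    Measurable fun e : History S A H t => ucbQ b e h s a := by
  by_cases hh : h < H
  · have e1 : ∀ e : History S A H t, ucbQ b e h s a = _ := fun e => by rw [ucbQ, dif_pos hh]
    rw [funext e1]
    have ih : ∀ s' a', Measurable fun e : History S A H t => ucbQ b e (h + 1) s' a' :=
      fun s' a' => measurable_ucbQ b (h + 1) s' a'
    have m1 : Measurable fun e : History S A H t => (empReward e ⟨h, hh⟩ s a : EReal) :=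
      (measurable_empReward _ s a).coe_real_ereal
    have m2 : Measurable fun e : History S A H t =>
        (b ⟨h, hh⟩ t (visits e ⟨h, hh⟩ s a) : EReal) :=
      ((measurable_of_countable (b ⟨h, hh⟩ t)).comp (measurable_visits _ s a)).coe_ereal_ennreal
    have m3 : ∀ s', Measurable fun e : History S A H t =>
        (empTrans e ⟨h, hh⟩ s a s' : EReal) * ⨆ a', ucbQ b e (h + 1) s' a' := fun s' =>
      (measurable_empTrans _ s a s').coe_real_ereal.mul (Measurable.iSup fun a' => ih s' a')
    exact (m1.add m2).add (Finset.measurable_sum _ fun s' _ => m3 s')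
  · have e1 : ∀ e : History S A H t, ucbQ b e h s a = 0 := fun e => by rw [ucbQ, dif_neg hh]
    rw [funext e1]
    exact measurable_const
termination_by H - h

theorem measurable_ucbGreedy_comp {β : Type*} [MeasurableSpace β] (b : Fin H → ℕ → ℕ → ℝ≥0∞)
    {t : ℕ} (h : Fin H) (s : S) (φ : Finset A → β) :
    Measurable fun e : History S A H t => φ (ucbGreedy b e h s) := by
  have h1 : ∀ a, MeasurableSet {e : History S A H t | a ∈ ucbGreedy b e h s} := by
    intro a
    have : {e : History S A H t | a ∈ ucbGreedy b e h s} =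
        ⋂ a', {e | ucbQ b e h s a' ≤ ucbQ b e h s a} := by
      ext e; simp [ucbGreedy]
    rw [this]
    exact MeasurableSet.iInter fun a' =>
      measurableSet_le (measurable_ucbQ b h s a') (measurable_ucbQ b h s a)
  have h2 : ∀ F : Finset A, MeasurableSet {e : History S A H t | ucbGreedy b e h s = F} := by
    intro F
    have : {e : History S A H t | ucbGreedy b e h s = F} =
        ⋂ a, {e | a ∈ ucbGreedy b e h s ↔ a ∈ F} := by
      ext e; simp [Finset.ext_iff]
    rw [this]
    refine MeasurableSet.iInter fun a => ?_
    by_cases ha : a ∈ F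
    · simpa [ha] using h1 a
    · simp only [ha, iff_false]
      exact (h1 a).compl
  intro V _
  have : (fun e : History S A H t => φ (ucbGreedy b e h s)) ⁻¹' V =
      ⋃ F ∈ {F : Finset A | φ F ∈ V}, {e | ucbGreedy b e h s = F} := by
    ext e; simp
  rw [this]
  exact MeasurableSet.biUnion (Set.to_countable _) fun F _ => h2 F

theorem isMeasurable_ucbvi (b : Fin H → ℕ → ℕ → ℝ≥0∞) (pick : Finset A → A) :
    SamplingRule.IsMeasurable (ucbvi b pick : SamplingRule Unit S A H) := by
  intro t
  refine measurable_pi_lambda _ fun h => measurable_pi_lambda _ fun s => ?_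
  exact (measurable_ucbGreedy_comp b h s pick).comp measurable_snd

end UCBMeasurability

/-! ### Decisions of UCBVI at the last stage -/

section UCBDecision

variable {S A : Type} {H : ℕ} [DecidableEq S] [DecidableEq A] [Fintype S] [Fintype A]

-- No next state is recorded after the last stage, so `empTrans` vanishes there and the index is
-- that of a bandit.
omit [Fintype A] in
theorem ucbQ_last (b : Fin H → ℕ → ℕ → ℝ≥0∞) {t : ℕ} (e : History S A H t) {h : Fin H}
    (hh : (h : ℕ) + 1 = H) (s : S) (a : A) :
    ucbQ b e h s a = (empReward e h s a : EReal) + (b h t (visits e h s a) : EReal) := by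
  rw [ucbQ, dif_pos h.2]
  have : ∀ s', empTrans e h s a s' = 0 := by
    intro s'
    have h0 : ¬ (h : ℕ) + 1 < H := by omega
    simp [empTrans, h0]
  simp [this]

theorem ucbGreedy_nonempty [Nonempty A] (b : Fin H → ℕ → ℕ → ℝ≥0∞) {t : ℕ}
    (e : History S A H t) (h : Fin H) (s : S) : (ucbGreedy b e h s).Nonempty := by
  obtain ⟨a, ha⟩ := Finite.exists_max fun a => ucbQ b e h s a
  exact ⟨a, by simpa [ucbGreedy] using ha⟩

/-- The Hoeffding bonus. -/
noncomputable def hoeffdingBonus (S A H t n : ℕ) : ℝ :=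
  Real.sqrt (2 * Real.log (2 * S * A * H * (t : ℝ) ^ 2) / n)

theorem hoeffdingBonus_nonneg (S A H t n : ℕ) : 0 ≤ hoeffdingBonus S A H t n := Real.sqrt_nonneg _

/-- If UCBVI plays a known action at the last stage, then all other actions are known and have
smaller indices. -/
theorem index_le_of_ucbGreedy {NS NA : ℕ} {b : Fin H → ℕ → ℕ → ℝ≥0∞}
    (hb : HasHoeffdingLastBonus NS NA H b) {t : ℕ} {e : History S A H t} {h : Fin H}
    (hh : (h : ℕ) + 1 = H) {s : S} {a : A} (ha : a ∈ ucbGreedy b e h s)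
    (hn : visits e h s a ≠ 0) (a' : A) :
    visits e h s a' ≠ 0 ∧
      empReward e h s a' + hoeffdingBonus NS NA H t (visits e h s a') ≤
      empReward e h s a + hoeffdingBonus NS NA H t (visits e h s a) := by
  have h1 : ucbQ b e h s a' ≤ ucbQ b e h s a := by
    simp only [ucbGreedy, Finset.mem_filter, Finset.mem_univ, true_and] at ha
    exact ha a'
  rw [ucbQ_last b e hh, ucbQ_last b e hh, hb h hh, hb h hh, if_neg hn] at h1
  have hreal : (empReward e h s a : EReal) + ((ENNReal.ofReal (Real.sqrt
      (2 * Real.log (2 * NS * NA * H * (t : ℝ) ^ 2) / (visits e h s a : ℕ))) : ℝ≥0∞) : EReal) =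
      ((empReward e h s a + hoeffdingBonus NS NA H t (visits e h s a) : ℝ) : EReal) := by
    rw [EReal.coe_ennreal_ofReal, max_eq_left (Real.sqrt_nonneg _)]
    rfl
  rw [hreal] at h1
  -- The index of `a` is finite, whereas that of an unvisited action would be `⊤`.
  by_cases hn' : visits e h s a' = 0
  · rw [if_pos hn'] at h1
    rw [EReal.coe_ennreal_top, EReal.coe_add_top, top_le_iff] at h1
    exact absurd h1 (EReal.coe_ne_top _)
  · refine ⟨hn', ?_⟩
    rw [if_neg hn', EReal.coe_ennreal_ofReal, max_eq_left (Real.sqrt_nonneg _)] at h1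
    unfold hoeffdingBonus at h1 ⊢
    exact_mod_cast h1

end UCBDecision

/-! ### Visit counts and deviations of empirical means -/

section Counting

variable {U : Type*} {S A : Type} {H : ℕ} [DecidableEq S] [DecidableEq A]

/-- The number of visits of `c` at stage `h₀` in the first `t` episodes. -/
def MDP.leafCount (M : MDP S A H) (alg : SamplingRule U S A H) (h₀ : Fin H) (c : S × A) (t : ℕ)
    (ω : U × Noise S A H) : ℕ :=
  visits (M.history alg t ω) h₀ c.1 c.2

/-- The sum of the rewards of `c` at stage `h₀` in the first `t` episodes, centered at `m`. -/
def MDP.leafDev (M : MDP S A H) (alg : SamplingRule U S A H) (h₀ : Fin H) (c : S × A) (m : ℝ)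
    (t : ℕ) (ω : U × Noise S A H) : ℝ :=
  ∑ i ∈ Finset.range t, if leafPair h₀ (M.episode alg ω i) = c then
    leafReward h₀ (M.episode alg ω i) - m else 0

variable (M : MDP S A H) (alg : SamplingRule U S A H) (h₀ : Fin H) (c : S × A) (m : ℝ)
  (ω : U × Noise S A H)

theorem MDP.leafCount_eq_sum (t : ℕ) : M.leafCount alg h₀ c t ω =
    ∑ i ∈ Finset.range t, if leafPair h₀ (M.episode alg ω i) = c then 1 else 0 := by
  rw [MDP.leafCount, visits, Finset.card_filter,
    ← Fin.sum_univ_eq_sum_range (fun i => if leafPair h₀ (M.episode alg ω i) = c then 1 else 0) t]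
  refine Finset.sum_congr rfl fun i _ => ?_
  exact if_congr (by simp [MDP.history, leafPair, Prod.ext_iff]) rfl rfl

theorem MDP.leafCount_mono : Monotone fun t => M.leafCount alg h₀ c t ω := by
  refine monotone_nat_of_le_succ fun t => ?_
  rw [MDP.leafCount_eq_sum, MDP.leafCount_eq_sum, Finset.sum_range_succ]
  exact Nat.le_add_right _ _

theorem MDP.leafCount_succ (t : ℕ) : M.leafCount alg h₀ c (t + 1) ω = M.leafCount alg h₀ c t ω +
    if leafPair h₀ (M.episode alg ω t) = c then 1 else 0 := by
  rw [MDP.leafCount_eq_sum, MDP.leafCount_eq_sum, Finset.sum_range_succ]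

theorem MDP.leafCount_le (t : ℕ) : M.leafCount alg h₀ c t ω ≤ t := by
  unfold MDP.leafCount visits
  exact (Finset.card_filter_le _ _).trans (by simp)

theorem MDP.leafDev_eq (t : ℕ) (h : M.leafCount alg h₀ c t ω ≠ 0) :
    M.leafDev alg h₀ c m t ω = M.leafCount alg h₀ c t ω *
      (empReward (M.history alg t ω) h₀ c.1 c.2 - m) := by
  have h' : (M.leafCount alg h₀ c t ω : ℝ) ≠ 0 := by exact_mod_cast h
  have e1 : empReward (M.history alg t ω) h₀ c.1 c.2 =
      (∑ i ∈ Finset.range t, if leafPair h₀ (M.episode alg ω i) = c then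
        leafReward h₀ (M.episode alg ω i) else 0) / M.leafCount alg h₀ c t ω := by
    unfold empReward
    congr 1
    rw [← Fin.sum_univ_eq_sum_range (fun i => if leafPair h₀ (M.episode alg ω i) = c then
        leafReward h₀ (M.episode alg ω i) else 0) t]
    refine Finset.sum_congr rfl fun i _ => ?_
    exact if_congr (by simp [MDP.history, leafPair, Prod.ext_iff]) rfl rfl
  rw [e1, mul_sub, mul_div_cancel₀ _ h', MDP.leafCount_eq_sum, MDP.leafDev]
  push_cast
  rw [Finset.sum_mul, ← Finset.sum_sub_distrib]
  refine Finset.sum_congr rfl fun i _ => ?_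
  split_ifs <;> simp

/-- Each visit raises the count by one, so the counts found at the visits run through `0, 1, 2, …`
once each. Sums over time become sums over counts, with no repetition. -/
theorem MDP.sum_leafCount_eq (φ : ℕ → ℝ≥0∞) (T : ℕ) :
    (∑ t ∈ Finset.range T, if leafPair h₀ (M.episode alg ω t) = c then
      φ (M.leafCount alg h₀ c t ω) else 0) =
      ∑ n ∈ Finset.range (M.leafCount alg h₀ c T ω), φ n := by
  induction T with
  | zero => simp [MDP.leafCount_eq_sum]
  | succ T ih =>
    rw [Finset.sum_range_succ, ih, MDP.leafCount_succ]
    split_ifs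
    · rw [Finset.sum_range_succ]
    · simp

/-- At some time up to `T`, there are exactly `n` visits of `c`, and the mean of the observed
rewards deviates from `m` by at least `l`, in the direction of `l`. -/
def MDP.devEvent (l : ℝ) (n T : ℕ) : Set (U × Noise S A H) :=
  ⋃ t ∈ Finset.range (T + 1),
    {ω | M.leafCount alg h₀ c t ω = n ∧ n * l ^ 2 ≤ l * M.leafDev alg h₀ c m t ω}

end Counting

/-! ### Concentration under adaptive sampling -/

section Concentration

variable {U : Type*} {S A : Type} {H : ℕ} [DecidableEq S] [DecidableEq A] [MeasurableSpace U]
  [MeasurableSpace S] [Finite S] [MeasurableSingletonClass S]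
  [MeasurableSpace A] [Finite A] [MeasurableSingletonClass A]

omit [DecidableEq S] [DecidableEq A] in
theorem MDP.measurableSet_leafPair (M : MDP S A H) {alg : SamplingRule U S A H}
    (halg : alg.IsMeasurable) (h₀ : Fin H) (c : S × A) (t : ℕ) :
    MeasurableSet {ω | leafPair h₀ (M.episode alg ω t) = c} :=
  ((measurable_leafPair h₀).comp (M.measurable_episode halg t)) (measurableSet_singleton c)

theorem MDP.measurableSet_devEvent (M : MDP S A H) {alg : SamplingRule U S A H}
    (halg : alg.IsMeasurable) (h₀ : Fin H) (c : S × A) (m l : ℝ) (n T : ℕ) :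
    MeasurableSet (M.devEvent alg h₀ c m l n T) := by
  refine Finset.measurableSet_biUnion _ fun t _ => ?_
  have h1 : Measurable fun ω => M.leafCount alg h₀ c t ω :=
    (measurable_visits h₀ c.1 c.2).comp (M.measurable_history halg t)
  have h2 : Measurable fun ω => M.leafDev alg h₀ c m t ω :=
    Finset.measurable_sum _ fun i _ => Measurable.ite (M.measurableSet_leafPair halg h₀ c i)
      (((measurable_leafReward h₀).comp (M.measurable_episode halg i)).sub_const m)
      measurable_const
  exact (h1 (measurableSet_singleton n)).inter
    (measurableSet_le measurable_const (h2.const_mul l))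

-- Every visit of `c` before time `t` finds fewer than `n` earlier ones, so the gate is open; from
-- time `t` on the count is at least `n` and the gate is closed.
omit [MeasurableSpace U] [MeasurableSpace S] [Finite S] [MeasurableSingletonClass S]
  [MeasurableSpace A] [Finite A] [MeasurableSingletonClass A] in
theorem sum_gated_eq_of_leafCount_eq (M : MDP S A H) (alg : SamplingRule U S A H) (h₀ : Fin H)
    (c : S × A) (m l : ℝ) {n t T : ℕ} (htT : t ≤ T) {ω : U × Noise S A H}
    (hn : M.leafCount alg h₀ c t ω = n) :
    ∑ i ∈ Finset.range T, (l * gatedReward (fun i => {x : U × History S A H i |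
        visits x.2 h₀ c.1 c.2 < n}) h₀ c m i ((ω.1, M.history alg i ω), M.episode alg ω i) -
      l ^ 2 / 2 * gatedVisit (fun i => {x : U × History S A H i |
        visits x.2 h₀ c.1 c.2 < n}) h₀ c i ((ω.1, M.history alg i ω), M.episode alg ω i)) =
    l * M.leafDev alg h₀ c m t ω - l ^ 2 / 2 * n := by
  have hgate : ∀ i, (((ω.1, M.history alg i ω) : U × History S A H i) ∈
      {x : U × History S A H i | visits x.2 h₀ c.1 c.2 < n}) ↔ M.leafCount alg h₀ c i ω < n :=
    fun i => Iff.rfl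
  have hclosed : ∀ i, t ≤ i → ¬ M.leafCount alg h₀ c i ω < n := by
    intro i hi
    have := M.leafCount_mono alg h₀ c ω hi
    simp only at this
    omega
  have hopen : ∀ i, i < t → leafPair h₀ (M.episode alg ω i) = c →
      M.leafCount alg h₀ c i ω < n := by
    intro i hi hp
    have h1 := M.leafCount_mono alg h₀ c ω (Nat.succ_le_of_lt hi)
    have h2 := M.leafCount_succ alg h₀ c ω i
    rw [if_pos hp] at h2
    simp only [Nat.succ_eq_add_one] at h1
    omega
  have hsub : Finset.range t ⊆ Finset.range T := Finset.range_subset_range.2 htT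
  rw [← Finset.sum_subset hsub]
  · have hN : (n : ℝ) = ∑ i ∈ Finset.range t,
        if leafPair h₀ (M.episode alg ω i) = c then (1 : ℝ) else 0 := by
      rw [← hn, MDP.leafCount_eq_sum]
      push_cast
      rfl
    rw [MDP.leafDev, hN, Finset.mul_sum, Finset.mul_sum, ← Finset.sum_sub_distrib]
    refine Finset.sum_congr rfl fun i hi => ?_
    simp only [gatedReward, gatedVisit, hgate]
    by_cases hp : leafPair h₀ (M.episode alg ω i) = c
    · simp [hp, hopen i (Finset.mem_range.1 hi) hp]
    · simp [hp]
  · intro i _ hi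
    have hi' : t ≤ i := by simpa using hi
    simp [gatedReward, gatedVisit, hgate, hclosed i hi']

/-- Concentration of the mean of the first `n` rewards of a pair, under adaptive sampling. -/
theorem law_devEvent_le (s₁ : S) (next : Fin H → S → A → S) (h₀ : Fin H) (f : S × A → ℝ)
    (c : S × A) (l : ℝ) (ν : Measure U) [IsProbabilityMeasure ν] {alg : SamplingRule U S A H}
    (halg : alg.IsMeasurable) (n T : ℕ) :
    (leafMDP s₁ next h₀ f).law ν ((leafMDP s₁ next h₀ f).devEvent alg h₀ c (f c) l n T) ≤
      ENNReal.ofReal (Real.exp (-(n * l ^ 2 / 2))) := by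
  set M := leafMDP s₁ next h₀ f with hM
  -- This gate freezes the tilt after the `n`-th visit. One Markov inequality at time `T` thus
  -- covers all times `t ≤ T` with count `n`: on the event the frozen exponent is at least `n * l ^
  -- 2 / 2`.
  let g : (i : ℕ) → Set (U × History S A H i) := fun i => {x | visits x.2 h₀ c.1 c.2 < n}
  have hg : ∀ i, MeasurableSet (g i) := fun i =>
    measurableSet_lt ((measurable_visits h₀ c.1 c.2).comp measurable_snd) measurable_const
  have h1 := lintegral_gatedTilt s₁ next h₀ f c l ν halg hg T
  rw [← hM] at h1
  have hmeas : Measurable fun ω => gatedTilt g h₀ c (f c) l T (ω.1, M.history alg T ω) :=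
    (measurable_gatedTilt hg h₀ c (f c) l T).comp
      (measurable_fst.prodMk (M.measurable_history halg T))
  have h2 := meas_ge_le_lintegral_div (μ := M.law ν) hmeas.aemeasurable
    (ε := ENNReal.ofReal (Real.exp (n * l ^ 2 / 2)))
    (by simpa using Real.exp_pos _) ENNReal.ofReal_ne_top
  rw [h1, one_div, ← ENNReal.ofReal_inv_of_pos (Real.exp_pos _), ← Real.exp_neg] at h2
  refine (measure_mono fun ω hω => ?_).trans h2
  simp only [MDP.devEvent, Set.mem_iUnion, Finset.mem_range] at hω
  obtain ⟨t, ht, hn, hdev⟩ := hω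
  simp only [Set.mem_ofPred_eq]
  rw [gatedTilt_eq_ofReal_exp, sum_gated_eq_of_leafCount_eq M alg h₀ c (f c) l
    (Nat.lt_succ_iff.1 ht) hn]
  refine ENNReal.ofReal_le_ofReal (Real.exp_le_exp.2 ?_)
  linarith

end Concentration

/-! ### Two series -/

section Series

theorem sum_exp_neg_mul_le {k : ℝ} (hk : 0 < k) (T : ℕ) :
    ∑ n ∈ Finset.Ioo 0 T, Real.exp (-(n * k)) ≤ 1 / k := by
  have hIco : Finset.Ioo 0 T = Finset.Ico 1 T := by
    ext n; simp only [Finset.mem_Ioo, Finset.mem_Ico]; omega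
  rw [hIco]
  rcases Nat.eq_zero_or_pos T with rfl | hT
  · simp [hk.le]
  -- The bound is the integral of `exp (-k x)` over `[0, T - 1]`; keeping its remainder makes the
  -- induction work, by `1 + k ≤ exp k`.
  have h : ∀ T : ℕ, 1 ≤ T → ∑ n ∈ Finset.Ico 1 T, Real.exp (-(n * k)) ≤
      (1 - Real.exp (-((T - 1 : ℝ) * k))) / k := by
    intro T hT
    induction T, hT using Nat.le_induction with
    | base => simp
    | succ T hT ih =>
      rw [Finset.sum_Ico_succ_top hT]
      have e1 : Real.exp (-((T - 1 : ℝ) * k)) = Real.exp (-(T * k)) * Real.exp k := by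
        rw [← Real.exp_add]; congr 1; ring
      rw [e1, le_div_iff₀ hk] at ih
      have h2 := Real.add_one_le_exp k
      have h3 := Real.exp_pos (-(T * k))
      rw [le_div_iff₀ hk, add_mul]
      push_cast
      rw [add_sub_cancel_right]
      nlinarith
  refine (h T hT).trans ?_
  gcongr
  have := Real.exp_pos (-((T - 1 : ℝ) * k))
  linarith

theorem sum_Ioo_one_div_sq_le (T : ℕ) : ∑ t ∈ Finset.Ioo 0 T, 1 / (t : ℝ) ^ 2 ≤ 2 := by
  have := sum_Ioo_inv_sq_le (α := ℝ) 0 T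
  simpa using this

end Series

/-! ### The expected number of visits of the bad leaf -/

section Regret

variable {S A : Type} {H : ℕ} [DecidableEq S] [DecidableEq A] [Fintype S] [Fintype A]

theorem mem_ucbGreedy_of_leafPair [Nonempty A] (M : MDP S A H) (b : Fin H → ℕ → ℕ → ℝ≥0∞)
    {pick : Finset A → A} (hpick : ∀ F : Finset A, F.Nonempty → pick F ∈ F) {h₀ : Fin H} {t : ℕ}
    {ω : Unit × Noise S A H} {c : S × A}
    (h : leafPair h₀ (M.episode (ucbvi b pick) ω t) = c) :
    c.2 ∈ ucbGreedy b (M.history (ucbvi b pick) t ω) h₀ c.1 := by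
  have h1 : c.2 = pick (ucbGreedy b (M.history (ucbvi b pick) t ω) h₀ c.1) := by
    rw [← h, MDP.episode]
    rfl
  rw [h1]
  exact hpick _ (ucbGreedy_nonempty _ _ _ _)

/-- Reasons for UCBVI to play a last-stage action that is worse by `ε` than another one: its reward
was overestimated, the other one was underestimated, or there are few visits. -/
theorem mem_devEvent_of_pull [Nonempty A] (M : MDP S A H) {NS NA : ℕ}
    (hq : 1 ≤ 2 * (NS : ℝ) * NA * H) {b : Fin H → ℕ → ℕ → ℝ≥0∞}
    (hb : HasHoeffdingLastBonus NS NA H b)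
    {pick : Finset A → A} (hpick : ∀ F : Finset A, F.Nonempty → pick F ∈ F) {h₀ : Fin H}
    (hh : (h₀ : ℕ) + 1 = H) {t T : ℕ} (htT : t < T) {ω : Unit × Noise S A H} {s : S} {a a' : A}
    {m ε : ℝ} (hε : 0 < ε)
    (hpull : leafPair h₀ (M.episode (ucbvi b pick) ω t) = (s, a))
    (hn : M.leafCount (ucbvi b pick) h₀ (s, a) t ω ≠ 0)
    (hlarge : 8 * Real.log (2 * NS * NA * H * (T : ℝ) ^ 2) / ε ^ 2 <
      M.leafCount (ucbvi b pick) h₀ (s, a) t ω) :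
    ω ∈ M.devEvent (ucbvi b pick) h₀ (s, a) (m - ε) (ε / 4)
        (M.leafCount (ucbvi b pick) h₀ (s, a) t ω) T ∨
      M.leafCount (ucbvi b pick) h₀ (s, a') t ω ≠ 0 ∧
      ω ∈ M.devEvent (ucbvi b pick) h₀ (s, a') m
        (-(hoeffdingBonus NS NA H t (M.leafCount (ucbvi b pick) h₀ (s, a') t ω) + ε / 4))
        (M.leafCount (ucbvi b pick) h₀ (s, a') t ω) t := by
  set alg : SamplingRule Unit S A H := ucbvi b pick with halg
  have hgreedy := mem_ucbGreedy_of_leafPair M b hpick hpull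
  obtain ⟨hn', hidx⟩ := index_le_of_ucbGreedy hb hh hgreedy hn a'
  set n₀ := M.leafCount alg h₀ (s, a) t ω with hn₀
  set n₁ := M.leafCount alg h₀ (s, a') t ω with hn₁
  change n₁ ≠ 0 at hn'
  change empReward (M.history alg t ω) h₀ s a' + hoeffdingBonus NS NA H t n₁ ≤
    empReward (M.history alg t ω) h₀ s a + hoeffdingBonus NS NA H t n₀ at hidx
  have hn₀pos : (0 : ℝ) < n₀ := by exact_mod_cast Nat.pos_of_ne_zero hn
  have ht1 : 1 ≤ t := by
    have := M.leafCount_le alg h₀ (s, a) ω t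
    omega
  -- The threshold in `hlarge` is the number of visits that brings the bonus down to `ε / 2`.
  have hB : hoeffdingBonus NS NA H t n₀ ≤ ε / 2 := by
    unfold hoeffdingBonus
    rw [Real.sqrt_le_left (by positivity), div_le_iff₀ hn₀pos]
    have hlog : Real.log (2 * NS * NA * H * (t : ℝ) ^ 2) ≤
        Real.log (2 * NS * NA * H * (T : ℝ) ^ 2) := by
      have ht1' : (1 : ℝ) ≤ t := by exact_mod_cast ht1
      refine Real.log_le_log (by positivity) ?_
      gcongr
    rw [div_lt_iff₀ (by positivity)] at hlarge
    nlinarith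
  -- Of the gap `ε`, the bonus of `a` bridges at most `ε / 2`. If the overestimation of `a` bridges
  -- less than `ε / 4`, then `a'` is underestimated by its own bonus plus at least `ε / 4`.
  by_cases h0 : n₀ * (ε / 4) ≤ M.leafDev alg h₀ (s, a) (m - ε) t ω
  · left
    simp only [MDP.devEvent, Set.mem_iUnion, Finset.mem_range]
    refine ⟨t, by omega, rfl, ?_⟩
    have := mul_le_mul_of_nonneg_left h0 (by positivity : 0 ≤ ε / 4)
    linarith
  · right
    refine ⟨hn', ?_⟩
    simp only [MDP.devEvent, Set.mem_iUnion, Finset.mem_range]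
    refine ⟨t, by omega, rfl, ?_⟩
    rw [M.leafDev_eq alg h₀ (s, a) (m - ε) ω t hn] at h0
    rw [M.leafDev_eq alg h₀ (s, a') m ω t hn']
    have h1 : empReward (M.history alg t ω) h₀ s a - (m - ε) < ε / 4 := by
      by_contra hc
      exact h0 (mul_le_mul_of_nonneg_left (not_lt.1 hc) hn₀pos.le)
    set B := hoeffdingBonus NS NA H t n₁ with hBdef
    have hB0 : 0 ≤ B := hoeffdingBonus_nonneg _ _ _ _ _
    have h2 : empReward (M.history alg t ω) h₀ s a' - m ≤ -(B + ε / 4) := by linarith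
    have h3 : 0 ≤ (n₁ : ℝ) * (B + ε / 4) := by positivity
    have h4 := mul_le_mul_of_nonneg_left h2 h3
    change (n₁ : ℝ) * (-(B + ε / 4)) ^ 2 ≤
      -(B + ε / 4) * (n₁ * (empReward (M.history alg t ω) h₀ s a' - m))
    linarith

theorem sum_indicator_le_natCast {x : ℝ} (hx : 0 ≤ x) (T : ℕ) :
    (∑ n ∈ Finset.range T, if n ≠ 0 ∧ (n : ℝ) ≤ x then (1 : ℝ≥0∞) else 0) ≤ ENNReal.ofReal x := by
  rw [← Finset.sum_filter]
  simp only [Finset.sum_const, nsmul_eq_mul, mul_one]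
  have h1 : (Finset.range T).filter (fun n : ℕ => n ≠ 0 ∧ (n : ℝ) ≤ x) ⊆ Finset.Icc 1 ⌊x⌋₊ := by
    intro n hn
    simp only [Finset.mem_filter] at hn
    rw [Finset.mem_Icc]
    exact ⟨Nat.pos_of_ne_zero hn.2.1, Nat.le_floor hn.2.2⟩
  have h2 := Finset.card_le_card h1
  rw [Nat.card_Icc, Nat.add_sub_cancel] at h2
  rw [← ENNReal.ofReal_natCast]
  refine ENNReal.ofReal_le_ofReal ?_
  exact (Nat.cast_le.2 h2).trans (Nat.floor_le hx)

-- A pull of the bad pair has count zero, or count at most `x`, or comes with a deviation of its own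
-- mean, or with one of the other action's mean. The first three depend on time only through the
-- count, so each count is charged once. The threshold of the last contains the bonus, which depends
-- on `t`, and forces a sum over times too.
open Classical in
theorem sum_pull_le [Nonempty A] (M : MDP S A H) {NS NA : ℕ}
    (hq : 1 ≤ 2 * (NS : ℝ) * NA * H) {b : Fin H → ℕ → ℕ → ℝ≥0∞}
    (hb : HasHoeffdingLastBonus NS NA H b)
    {pick : Finset A → A} (hpick : ∀ F : Finset A, F.Nonempty → pick F ∈ F) {h₀ : Fin H}
    (hh : (h₀ : ℕ) + 1 = H) {T : ℕ} (hT : 1 ≤ T) (ω : Unit × Noise S A H) (s : S) (a a' : A)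
    (m : ℝ) {ε : ℝ} (hε : 0 < ε) :
    (∑ t ∈ Finset.range T, if leafPair h₀ (M.episode (ucbvi b pick) ω t) = (s, a) then
      (1 : ℝ≥0∞) else 0) ≤
    1 + ENNReal.ofReal (8 * Real.log (2 * NS * NA * H * (T : ℝ) ^ 2) / ε ^ 2) +
      (∑ n ∈ Finset.Ioo 0 T, (M.devEvent (ucbvi b pick) h₀ (s, a) (m - ε) (ε / 4) n T).indicator
        1 ω) +
      ∑ t ∈ Finset.Ioo 0 T, ∑ n ∈ Finset.Ioo 0 T, (M.devEvent (ucbvi b pick) h₀ (s, a') m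
        (-(hoeffdingBonus NS NA H t n + ε / 4)) n t).indicator 1 ω := by
  set alg : SamplingRule Unit S A H := ucbvi b pick with halg
  set x := 8 * Real.log (2 * NS * NA * H * (T : ℝ) ^ 2) / ε ^ 2 with hx
  have hx0 : 0 ≤ x := by
    have hT' : (1 : ℝ) ≤ T := by exact_mod_cast hT
    have : 0 ≤ Real.log (2 * NS * NA * H * (T : ℝ) ^ 2) := by
      refine Real.log_nonneg ?_
      nlinarith
    positivity
  let D₀ : ℕ → ℝ≥0∞ := fun n => (M.devEvent alg h₀ (s, a) (m - ε) (ε / 4) n T).indicator 1 ω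
  let D₁ : ℕ → ℕ → ℝ≥0∞ := fun t n => (M.devEvent alg h₀ (s, a') m
        (-(hoeffdingBonus NS NA H t n + ε / 4)) n t).indicator 1 ω
  let φ : ℕ → ℝ≥0∞ := fun n => (if n = 0 then 1 else 0) +
    (if n ≠ 0 ∧ (n : ℝ) ≤ x then 1 else 0) + if n ≠ 0 then D₀ n else 0
  have hpoint : ∀ t ∈ Finset.range T,
      (if leafPair h₀ (M.episode alg ω t) = (s, a) then (1 : ℝ≥0∞) else 0) ≤
      (if leafPair h₀ (M.episode alg ω t) = (s, a) then φ (M.leafCount alg h₀ (s, a) t ω) else 0) +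
        if t ≠ 0 then ∑ n ∈ Finset.Ioo 0 T, D₁ t n else 0 := by
    intro t ht
    rw [Finset.mem_range] at ht
    by_cases hpull : leafPair h₀ (M.episode alg ω t) = (s, a)
    · rw [if_pos hpull, if_pos hpull]
      by_cases hn : M.leafCount alg h₀ (s, a) t ω = 0
      · refine le_add_right ?_
        simp only [φ, hn, if_true]
        rw [add_assoc]
        exact le_self_add
      · by_cases hsmall : (M.leafCount alg h₀ (s, a) t ω : ℝ) ≤ x
        · refine le_add_right ?_
          have e : (if M.leafCount alg h₀ (s, a) t ω ≠ 0 ∧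
              (M.leafCount alg h₀ (s, a) t ω : ℝ) ≤ x then (1 : ℝ≥0∞) else 0) = 1 :=
            if_pos ⟨hn, hsmall⟩
          simp only [φ]
          rw [e]
          exact le_add_right le_add_self
        · rcases mem_devEvent_of_pull M hq hb hpick hh ht (a' := a') (m := m) hε hpull hn
            (not_le.1 hsmall) with hdev | ⟨hn', hdev⟩
          · refine le_add_right ?_
            simp only [φ, D₀]
            rw [if_pos hn, Set.indicator_of_mem hdev]
            exact le_add_self
          · have h1 := M.leafCount_le alg h₀ (s, a') ω t
            refine le_add_left ?_
            have ht0 : t ≠ 0 := fun h0 => hn' (Nat.le_zero.1 (h0 ▸ h1))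
            rw [if_pos ht0]
            refine le_trans ?_ (Finset.single_le_sum (fun _ _ => zero_le)
              (Finset.mem_Ioo.2 ⟨Nat.pos_of_ne_zero hn', h1.trans_lt ht⟩))
            simp only [D₁]
            rw [Set.indicator_of_mem hdev]
            exact le_rfl
    · rw [if_neg hpull]
      exact zero_le
  refine (Finset.sum_le_sum hpoint).trans ?_
  have hIoo : Finset.Ioo 0 T = (Finset.range T).filter fun n => n ≠ 0 := by
    ext n; simp only [Finset.mem_Ioo, Finset.mem_filter, Finset.mem_range]; omega
  rw [Finset.sum_add_distrib, M.sum_leafCount_eq alg h₀ (s, a) ω φ T]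
  refine add_le_add ?_ ?_
  · refine (Finset.sum_le_sum_of_subset (Finset.range_subset_range.2
      (M.leafCount_le alg h₀ (s, a) ω T))).trans ?_
    simp only [φ]
    rw [Finset.sum_add_distrib, Finset.sum_add_distrib]
    refine add_le_add (add_le_add ?_ (sum_indicator_le_natCast hx0 T)) ?_
    · rw [Finset.sum_ite_eq' (Finset.range T) 0 (fun _ => (1 : ℝ≥0∞))]
      split_ifs
      · exact le_rfl
      · exact zero_le
    · rw [hIoo, Finset.sum_filter]
  · rw [hIoo, Finset.sum_filter]

/-- The expected number of plays of a last-stage action that is worse by `ε` than another one. -/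
theorem lintegral_sum_pull_le [MeasurableSpace S] [MeasurableSingletonClass S]
    [MeasurableSpace A] [MeasurableSingletonClass A] (s₁ : S) (next : Fin H → S → A → S)
    {NS NA : ℕ} (hq : 48 ≤ 2 * (NS : ℝ) * NA * H) {b : Fin H → ℕ → ℕ → ℝ≥0∞}
    (hb : HasHoeffdingLastBonus NS NA H b)
    {pick : Finset A → A} (hpick : ∀ F : Finset A, F.Nonempty → pick F ∈ F) {h₀ : Fin H}
    (hh : (h₀ : ℕ) + 1 = H) {T : ℕ} (hT : 1 ≤ T) (f : S × A → ℝ) (s : S) (a a' : A)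
    {ε : ℝ} (hε : 0 < ε) (hf : f (s, a) = f (s, a') - ε) :
    ∑ t ∈ Finset.range T, (leafMDP s₁ next h₀ f).law (Measure.dirac ())
      {ω | leafPair h₀ ((leafMDP s₁ next h₀ f).episode (ucbvi b pick) ω t) = (s, a)} ≤
    ENNReal.ofReal (1 + (8 * Real.log (2 * NS * NA * H * (T : ℝ) ^ 2) + 34) / ε ^ 2) := by
  classical
  have : Nonempty A := ⟨a⟩
  set M := leafMDP s₁ next h₀ f with hM
  set alg : SamplingRule Unit S A H := ucbvi b pick with halg
  have hmeas : alg.IsMeasurable := isMeasurable_ucbvi b pick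
  set μ := M.law (Measure.dirac ()) with hμ
  set q : ℝ := 2 * (NS : ℝ) * NA * H with hqdef
  have hT' : (1 : ℝ) ≤ T := by exact_mod_cast hT
  have hlog : 0 ≤ Real.log (q * (T : ℝ) ^ 2) := Real.log_nonneg (by nlinarith)
  have hD₀ := fun n => M.measurableSet_devEvent hmeas h₀ (s, a) (f (s, a') - ε) (ε / 4) n T
  have hD₁ := fun t n => M.measurableSet_devEvent hmeas h₀ (s, a') (f (s, a'))
    (-(hoeffdingBonus NS NA H t n + ε / 4)) n t
  have hleft : ∑ t ∈ Finset.range T, μ {ω | leafPair h₀ (M.episode alg ω t) = (s, a)} =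
      ∫⁻ ω, ∑ t ∈ Finset.range T, (if leafPair h₀ (M.episode alg ω t) = (s, a) then
        (1 : ℝ≥0∞) else 0) ∂μ := by
    rw [lintegral_finsetSum]
    · refine Finset.sum_congr rfl fun t _ => ?_
      rw [← lintegral_indicator_one (M.measurableSet_leafPair hmeas h₀ (s, a) t)]
      refine lintegral_congr fun ω => ?_
      rw [Set.indicator_apply]
      exact if_congr Iff.rfl rfl rfl
    · exact fun t _ => Measurable.ite (M.measurableSet_leafPair hmeas h₀ (s, a) t)
        measurable_const measurable_const
  rw [hleft]
  refine (lintegral_mono fun ω => sum_pull_le M (by linarith) hb hpick hh hT ω s a a'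
    (f (s, a')) hε).trans ?_
  rw [lintegral_add_right, lintegral_add_right, lintegral_const, measure_univ, mul_one,
    lintegral_finsetSum, lintegral_finsetSum]
  rotate_left
  · exact fun t _ => Finset.measurable_sum _ fun n _ => measurable_one.indicator (hD₁ t n)
  · exact fun n _ => measurable_one.indicator (hD₀ n)
  · exact Finset.measurable_sum _ fun n _ => measurable_one.indicator (hD₀ n)
  · exact Finset.measurable_sum _ fun t _ => Finset.measurable_sum _ fun n _ =>
      measurable_one.indicator (hD₁ t n)
  have hk : 0 < ε ^ 2 / 32 := by positivity
  have hsum₀ : ∑ n ∈ Finset.Ioo 0 T, ∫⁻ ω, (M.devEvent alg h₀ (s, a) (f (s, a') - ε)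
      (ε / 4) n T).indicator 1 ω ∂μ ≤ ENNReal.ofReal (32 / ε ^ 2) := by
    have h1 : ∀ n ∈ Finset.Ioo 0 T, ∫⁻ ω, (M.devEvent alg h₀ (s, a) (f (s, a') - ε)
        (ε / 4) n T).indicator 1 ω ∂μ ≤ ENNReal.ofReal (Real.exp (-(n * (ε ^ 2 / 32)))) := by
      intro n _
      rw [lintegral_indicator_one (hD₀ n), ← hf]
      refine (law_devEvent_le s₁ next h₀ f (s, a) (ε / 4) _ hmeas n T).trans (le_of_eq ?_)
      congr 3
      ring
    refine (Finset.sum_le_sum h1).trans ?_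
    rw [← ENNReal.ofReal_sum_of_nonneg fun _ _ => (Real.exp_pos _).le]
    refine ENNReal.ofReal_le_ofReal ((sum_exp_neg_mul_le hk T).trans (le_of_eq ?_))
    rw [one_div_div]
  have hsum₁ : ∑ t ∈ Finset.Ioo 0 T, ∫⁻ ω, ∑ n ∈ Finset.Ioo 0 T, (M.devEvent alg h₀ (s, a')
      (f (s, a')) (-(hoeffdingBonus NS NA H t n + ε / 4)) n t).indicator 1 ω ∂μ ≤
      ENNReal.ofReal (2 / ε ^ 2) := by
    have h1 : ∀ t ∈ Finset.Ioo 0 T, ∫⁻ ω, ∑ n ∈ Finset.Ioo 0 T, (M.devEvent alg h₀ (s, a')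
        (f (s, a')) (-(hoeffdingBonus NS NA H t n + ε / 4)) n t).indicator 1 ω ∂μ ≤
        ENNReal.ofReal (1 / ε ^ 2 * (1 / (t : ℝ) ^ 2)) := by
      intro t ht
      have ht1 : (1 : ℝ) ≤ t := by exact_mod_cast (Finset.mem_Ioo.1 ht).1
      have hqt : 1 ≤ q * (t : ℝ) ^ 2 := by nlinarith
      rw [lintegral_finsetSum _ fun n _ => measurable_one.indicator (hD₁ t n)]
      -- In the square of bonus plus `ε / 4` the cross term is dropped. The bonus contributes `1 /
      -- (q t²)`; the extra `ε / 4` contributes a factor summable over `n`, which avoids losing a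
      -- factor `t` in the union over counts.
      have h2 : ∀ n ∈ Finset.Ioo 0 T, ∫⁻ ω, (M.devEvent alg h₀ (s, a')
          (f (s, a')) (-(hoeffdingBonus NS NA H t n + ε / 4)) n t).indicator 1 ω ∂μ ≤
          ENNReal.ofReal ((q * (t : ℝ) ^ 2)⁻¹ * Real.exp (-(n * (ε ^ 2 / 32)))) := by
        intro n hn
        have hn0 : (0 : ℝ) < n := by exact_mod_cast (Finset.mem_Ioo.1 hn).1
        rw [lintegral_indicator_one (hD₁ t n)]
        refine (law_devEvent_le s₁ next h₀ f (s, a') _ _ hmeas n t).trans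
          (ENNReal.ofReal_le_ofReal ?_)
        have hpos : 0 < q * (t : ℝ) ^ 2 := by linarith
        rw [← Real.exp_log (inv_pos.2 hpos), ← Real.exp_add, Real.log_inv]
        refine Real.exp_le_exp.2 ?_
        have hB0 := hoeffdingBonus_nonneg NS NA H t n
        have hB2 : n * hoeffdingBonus NS NA H t n ^ 2 = 2 * Real.log (q * (t : ℝ) ^ 2) := by
          unfold hoeffdingBonus
          rw [Real.sq_sqrt (div_nonneg (mul_nonneg two_pos.le (Real.log_nonneg hqt)) hn0.le),
            mul_div_cancel₀ _ hn0.ne']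
        have h3 : 0 ≤ (n : ℝ) * (hoeffdingBonus NS NA H t n * ε) := by positivity
        nlinarith
      refine (Finset.sum_le_sum h2).trans ?_
      rw [← ENNReal.ofReal_sum_of_nonneg fun _ _ => by positivity]
      refine ENNReal.ofReal_le_ofReal ?_
      rw [← Finset.mul_sum]
      have h4 := sum_exp_neg_mul_le hk T
      -- A value `q ≥ 32` absorbs the constant of the sum bound `32 / ε ^ 2`.
      have h5 : (q * (t : ℝ) ^ 2)⁻¹ ≤ (32 * (t : ℝ) ^ 2)⁻¹ := by
        gcongr
        linarith
      refine (mul_le_mul h5 h4 (Finset.sum_nonneg fun _ _ => (Real.exp_pos _).le)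
        (by positivity)).trans (le_of_eq ?_)
      field_simp
    refine (Finset.sum_le_sum h1).trans ?_
    rw [← ENNReal.ofReal_sum_of_nonneg fun _ _ => by positivity, ← Finset.mul_sum]
    refine ENNReal.ofReal_le_ofReal ?_
    refine (mul_le_mul_of_nonneg_left (sum_Ioo_one_div_sq_le T) (by positivity)).trans
      (le_of_eq ?_)
    ring
  refine (add_le_add (add_le_add le_rfl hsum₀) hsum₁).trans (le_of_eq ?_)
  rw [← ENNReal.ofReal_one, ← ENNReal.ofReal_add zero_le_one (by positivity),
    ← ENNReal.ofReal_add (by positivity) (by positivity),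
    ← ENNReal.ofReal_add (by positivity) (by positivity)]
  congr 1
  ring

end Regret

/-! ### From visits of the bad leaf to the regret time -/

section RegretTime

variable {U : Type*} {S A : Type} {H : ℕ} [MeasurableSpace U] [DecidableEq S] [DecidableEq A]
  [Fintype S] [Fintype A] [MeasurableSpace S] [MeasurableSingletonClass S] [MeasurableSpace A]
  [MeasurableSingletonClass A]

-- Regret refers to the policy, the visit counts to the observed pair. The two agree only almost
-- surely, since the noise table may contain wrong next states on a null set.
omit [DecidableEq S] [DecidableEq A] [Fintype S] [Fintype A] in
theorem law_leafOf_policyAt [Finite S] [Finite A] (s₁ : S) (next : Fin H → S → A → S)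
    (h₀ : Fin H) (m : Fin H → S → A → ℝ) (ν : Measure U) [IsProbabilityMeasure ν]
    {alg : SamplingRule U S A H} (halg : alg.IsMeasurable) (c : S × A) (t : ℕ) :
    (MDP.ofDet s₁ next m).law ν
        {ω | leafOf s₁ next h₀ ((MDP.ofDet s₁ next m).policyAt alg t ω) = c} =
      (MDP.ofDet s₁ next m).law ν
        {ω | leafPair h₀ ((MDP.ofDet s₁ next m).episode alg ω t) = c} := by
  classical
  set M := MDP.ofDet s₁ next m with hM
  have hF : Measurable fun p : (U × History S A H t) × Episode S A H =>
      if leafPair h₀ p.2 = c then (1 : ℝ≥0∞) else 0 :=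
    Measurable.ite (((measurable_leafPair h₀).comp measurable_snd) (measurableSet_singleton c))
      measurable_const measurable_const
  have e := MDP.lintegral_episode_ofDet s₁ next m ν halg t hF
  have hpol : MeasurableSet {ω | leafOf s₁ next h₀ (M.policyAt alg t ω) = c} :=
    M.measurable_policyAt halg t (Set.to_countable {π | leafOf s₁ next h₀ π = c}).measurableSet
  rw [← lintegral_indicator_one hpol,
    ← lintegral_indicator_one (M.measurableSet_leafPair halg h₀ c t)]
  refine Eq.trans ?_ (e.symm.trans ?_)
  · refine lintegral_congr fun ω => ?_
    by_cases h : leafOf s₁ next h₀ (M.policyAt alg t ω) = c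
    · rw [Set.indicator_of_mem (by exact h)]
      refine ((lintegral_congr fun r => if_pos h).trans ?_).symm
      simp
    · rw [Set.indicator_of_notMem (by exact h)]
      exact ((lintegral_congr fun r => if_neg h).trans lintegral_zero).symm
  · refine lintegral_congr fun ω => ?_
    rw [Set.indicator_apply]
    exact if_congr Iff.rfl rfl rfl

theorem avgRegret_oneBadLeaf {s₁ : S} {next : Fin H → S → A → S} {h₀ : Fin H}
    (hsurj : Function.Surjective (leafOf s₁ next h₀)) {c₀ c₁ : S × A} (hc : c₁ ≠ c₀) {ε : ℝ}
    (hε : 0 ≤ ε) (ν : Measure U) [IsProbabilityMeasure ν] {alg : SamplingRule U S A H}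
    (halg : alg.IsMeasurable) (T : ℕ) :
    (leafMDP s₁ next h₀ (oneBadLeaf c₀ ε)).avgRegret ν alg T =
      1 / (T : ℝ) * (ε * (∑ t ∈ Finset.range T, (leafMDP s₁ next h₀ (oneBadLeaf c₀ ε)).law ν
        {ω | leafPair h₀
          ((leafMDP s₁ next h₀ (oneBadLeaf c₀ ε)).episode alg ω t) = c₀}).toReal) := by
  set M := leafMDP s₁ next h₀ (oneBadLeaf c₀ ε) with hM
  have hopt : M.optValue = 0 := by
    rw [optValue_leafMDP hsurj (oneBadLeaf c₀ ε) (c := c₁), oneBadLeaf, if_neg hc]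
    intro c'
    simp only [oneBadLeaf, if_neg hc]
    split_ifs <;> linarith
  rw [MDP.avgRegret]
  congr 1
  rw [ENNReal.toReal_sum fun _ _ => measure_ne_top _ _, Finset.mul_sum]
  refine Finset.sum_congr rfl fun t _ => ?_
  have hpol : MeasurableSet {ω | leafOf s₁ next h₀ (M.policyAt alg t ω) = c₀} :=
    M.measurable_policyAt halg t (Set.to_countable {π | leafOf s₁ next h₀ π = c₀}).measurableSet
  have hfun : (fun ω => M.optValue - M.value (M.policyAt alg t ω)) =
      {ω | leafOf s₁ next h₀ (M.policyAt alg t ω) = c₀}.indicator fun _ => ε := by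
    funext ω
    rw [hopt, value_leafMDP, Set.indicator_apply, oneBadLeaf, zero_sub]
    by_cases h : leafOf s₁ next h₀ (M.policyAt alg t ω) = c₀
    · rw [if_pos h, if_pos (by exact h), neg_neg]
    · rw [if_neg h, if_neg (by exact h), neg_zero]
  rw [hfun, integral_indicator_const _ hpol, smul_eq_mul, mul_comm, Measure.real,
    law_leafOf_policyAt s₁ next h₀ _ ν halg c₀ t]

/-- The horizon at which a regret of `1 + (8 log (q T²) + 34) / ε²` per unit gap is small enough. -/
theorem exists_horizon {ε δ q : ℝ} (hε : 0 < ε) (hδ : 0 < δ) (hδ1 : δ < 1) (hq : 48 ≤ q) :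
    ∃ T : ℕ, 1 ≤ T ∧
      (T : ℝ) ≤ 2 / (ε ^ 2 * δ) * (36 * Real.log q + 16 * Real.log (17 / (ε ^ 2 * δ)) + 9 * ε ^ 2)
        + 1 ∧
      1 / (T : ℝ) * (ε * (1 + (8 * Real.log (q * (T : ℝ) ^ 2) + 34) / ε ^ 2)) ≤ ε * δ := by
  set x := ε ^ 2 * δ with hx
  have hx0 : 0 < x := by positivity
  have hxε : x ≤ ε ^ 2 := by
    rw [hx]; exact mul_le_of_le_one_right (by positivity) hδ1.le
  have hL : 1.38 ≤ Real.log q := by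
    have h1 : Real.log (2 ^ 2) ≤ Real.log q := Real.log_le_log (by norm_num) (by linarith)
    rw [Real.log_pow] at h1
    have := Real.log_two_gt_d9
    push_cast at h1
    linarith
  -- For large `ε` this logarithm may be negative; as `x ≤ ε ^ 2`, the term `9 * ε ^ 2` then
  -- compensates for it.
  have hlog17 : 1 - x / 17 ≤ Real.log (17 / x) := by
    have := Real.one_sub_inv_le_log_of_pos (show 0 < 17 / x by positivity)
    rwa [inv_div] at this
  set B := 2 / x * (36 * Real.log q + 16 * Real.log (17 / x) + 9 * ε ^ 2) with hB
  have hBpos : 0 < B := by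
    have : 0 < 36 * Real.log q + 16 * Real.log (17 / x) + 9 * ε ^ 2 := by linarith
    positivity
  refine ⟨⌈B⌉₊, Nat.one_le_ceil_iff.2 hBpos, (Nat.ceil_lt_add_one hBpos.le).le, ?_⟩
  set T : ℝ := (⌈B⌉₊ : ℝ) with hT
  have hBT : B ≤ T := Nat.le_ceil B
  have hT0 : 0 < T := hBpos.trans_le hBT
  have hTx : 2 * (36 * Real.log q + 16 * Real.log (17 / x) + 9 * ε ^ 2) ≤ T * x := by
    have := mul_le_mul_of_nonneg_right hBT hx0.le
    refine le_trans (le_of_eq ?_) this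
    rw [hB]
    field_simp
  -- The scale `32` is chosen so that `16 * log T` uses up only half of `T * x`.
  have hlogT : Real.log T ≤ T * x / 32 - 1 + (Real.log (17 / x) + 15 / 17) := by
    have e : T = T * x / 32 * (17 / x * (32 / 17)) := by field_simp
    have h1 : Real.log T = Real.log (T * x / 32) + (Real.log (17 / x) + Real.log (32 / 17)) := by
      rw [← Real.log_mul (by positivity) (by positivity),
        ← Real.log_mul (by positivity) (by positivity), ← e]
    have h2 := Real.log_le_sub_one_of_pos (show 0 < T * x / 32 by positivity)
    have h3 := Real.log_le_sub_one_of_pos (show (0 : ℝ) < 32 / 17 by norm_num)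
    linarith
  -- The other half of `T * x` has a surplus of `28 * log q + 8 * ε ^ 2` for the constant `18 + 240
  -- / 17`; `log q ≥ 1.38` is enough.
  have hmain : ε ^ 2 + 8 * (Real.log q + 2 * Real.log T) + 34 ≤ T * x := by
    have := sq_nonneg ε
    linarith
  rw [Real.log_mul (by linarith) (by positivity), Real.log_pow, one_div, inv_mul_le_iff₀ hT0]
  push_cast
  have e : ε * (1 + (8 * (Real.log q + 2 * Real.log T) + 34) / ε ^ 2) =
      (ε ^ 2 + 8 * (Real.log q + 2 * Real.log T) + 34) / ε := by
    field_simp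
    ring
  rw [e, div_le_iff₀ hε]
  refine hmain.trans (le_of_eq ?_)
  rw [hx]
  ring

theorem regretTime_oneBadLeaf_le {s₁ : S} {next : Fin H → S → A → S} {h₀ : Fin H}
    (hsurj : Function.Surjective (leafOf s₁ next h₀)) (hh : (h₀ : ℕ) + 1 = H)
    {NS NA : ℕ} (hq : 48 ≤ 2 * (NS : ℝ) * NA * H) {b : Fin H → ℕ → ℕ → ℝ≥0∞}
    (hb : HasHoeffdingLastBonus NS NA H b)
    {pick : Finset A → A} (hpick : ∀ F : Finset A, F.Nonempty → pick F ∈ F)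
    (s : S) {a a' : A} (ha : a' ≠ a) {ε δ : ℝ} (hε : 0 < ε) (hδ : 0 < δ) (hδ1 : δ < 1) :
    ((leafMDP s₁ next h₀ (oneBadLeaf (s, a) ε)).regretTime (Measure.dirac ()) (ucbvi b pick)
        (ε * δ) : ℝ≥0∞) ≤
      ENNReal.ofReal (2 / (ε ^ 2 * δ) * (36 * Real.log (2 * NS * NA * H) +
        16 * Real.log (17 / (ε ^ 2 * δ)) + 9 * ε ^ 2) + 1) := by
  set M := leafMDP s₁ next h₀ (oneBadLeaf (s, a) ε) with hM
  obtain ⟨T, hT1, hTle, hTreg⟩ := exists_horizon hε hδ hδ1 hq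
  have hc : ((s, a') : S × A) ≠ (s, a) := fun h => ha (Prod.ext_iff.1 h).2
  have hcount := lintegral_sum_pull_le s₁ next hq hb hpick hh hT1 (oneBadLeaf (s, a) ε) s a a' hε
    (by simp [oneBadLeaf, hc])
  have hT' : (1 : ℝ) ≤ T := by exact_mod_cast hT1
  have hnonneg : 0 ≤ 1 + (8 * Real.log (2 * NS * NA * H * (T : ℝ) ^ 2) + 34) / ε ^ 2 := by
    have : 0 ≤ Real.log (2 * NS * NA * H * (T : ℝ) ^ 2) := Real.log_nonneg (by nlinarith)
    positivity
  have hreg : M.avgRegret (Measure.dirac ()) (ucbvi b pick) T ≤ ε * δ := by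
    rw [hM, avgRegret_oneBadLeaf hsurj hc hε.le _ (isMeasurable_ucbvi b pick)]
    refine le_trans ?_ hTreg
    gcongr
    exact ENNReal.toReal_le_of_le_ofReal hnonneg hcount
  have hle : M.regretTime (Measure.dirac ()) (ucbvi b pick) (ε * δ) ≤ (T : ℕ∞) :=
    iInf₂_le (f := fun (T : ℕ)
      (_ : 1 ≤ T ∧ M.avgRegret (Measure.dirac ()) (ucbvi b pick) T ≤ ε * δ) => (T : ℕ∞)) T
      ⟨hT1, hreg⟩
  calc (M.regretTime (Measure.dirac ()) (ucbvi b pick) (ε * δ) : ℝ≥0∞)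
      ≤ ((T : ℕ∞) : ℝ≥0∞) := by exact_mod_cast hle
    _ = ENNReal.ofReal (T : ℝ) := by simp
    _ ≤ _ := ENNReal.ofReal_le_ofReal hTle

end RegretTime

/-! ### The instance and its two bounds -/

theorem theorem2 (S A H : ℕ) (hS : 4 ≤ S) (hA : 2 ≤ A) (hH : Nat.clog 2 S + 1 ≤ H)
    (ε : ℝ) (hε : 0 < ε) :
    ∃ M : MDP (Fin S) (Fin A) H,
      M.IsDeterministic ∧ M.HasUnitGaussianRewards ∧
      (∃ π : Policy (Fin S) (Fin A) H, M.optValue - M.value π = ε) ∧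
      (∀ (b : Fin H → ℕ → ℕ → ℝ≥0∞) (pick : Finset (Fin A) → Fin A),
        HasHoeffdingLastBonus S A H b →
        (∀ s : Finset (Fin A), s.Nonempty → pick s ∈ s) →
        ∀ δ : ℝ, 0 < δ → δ < 1 →
          (M.regretTime (Measure.dirac ()) (ucbvi b pick) (ε * δ) : ℝ≥0∞) ≤
            ENNReal.ofReal
              (2 / (ε ^ 2 * δ) *
                (36 * Real.log (2 * S * A * H) + 16 * Real.log (17 / (ε ^ 2 * δ)) + 9 * ε ^ 2)
                + 1)) ∧
      (∀ (U : Type*) [MeasurableSpace U] (alg : PACAlgorithm U (Fin S) (Fin A) H) (δ : ℝ),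
        0 < δ → δ < 1 →
        alg.IsPAC (MDP.gaussianDeterministic (Fin S) (Fin A) H) ε δ →
          ENNReal.ofReal (S * A * Real.log (1 / (4 * δ)) / (16 * ε ^ 2)) ≤ alg.expectedTau M) := by
  have hS0 : 0 < S := by omega
  have hH0 : 0 < H := by omega
  have hclog : 2 ≤ Nat.clog 2 S := by
    rw [← Nat.clog_pow 2 2 one_lt_two]
    exact Nat.clog_mono_right 2 hS
  have hSH : S ≤ 2 ^ (H - 1) :=
    (Nat.le_pow_clog one_lt_two S).trans (Nat.pow_le_pow_right two_pos (by omega))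
  have hsurj := leafOf_tree_surjective hS0 hA hH0 hSH
  let a₀ : Fin A := ⟨0, by omega⟩
  let a₁ : Fin A := ⟨1, by omega⟩
  have ha : a₁ ≠ a₀ := by simp [a₀, a₁]
  let s₀ : Fin S := ⟨0, hS0⟩
  refine ⟨leafMDP s₀ (treeNext hS0 A H) (lastStage hH0) (oneBadLeaf (s₀, a₀) ε),
    (ofDet_mem_gaussianDeterministic _ _ _).1, (ofDet_mem_gaussianDeterministic _ _ _).2,
    ?_, ?_, ?_⟩
  · obtain ⟨π, hπ⟩ := hsurj (s₀, a₀)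
    have hc : ((s₀, a₁) : Fin S × Fin A) ≠ (s₀, a₀) := fun h => ha (Prod.ext_iff.1 h).2
    refine ⟨π, ?_⟩
    rw [value_leafMDP, hπ, optValue_leafMDP hsurj _ (c := (s₀, a₁))]
    · simp [oneBadLeaf, ha]
    · intro c'
      simp only [oneBadLeaf, if_neg hc]
      split_ifs <;> linarith
  · intro b pick hb hpick δ hδ hδ1
    -- Here `H ≥ 3`, because `Nat.clog 2 S ≥ 2`.
    have hq : 48 ≤ 2 * (S : ℝ) * A * H := by
      have h1 : 4 * 2 * 3 ≤ S * A * H := by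
        gcongr
        omega
      have h2 : ((4 * 2 * 3 : ℕ) : ℝ) ≤ ((S * A * H : ℕ) : ℝ) := Nat.cast_le.2 h1
      push_cast at h2
      linarith
    refine regretTime_oneBadLeaf_le hsurj ?_ hq hb hpick s₀ ha hε hδ hδ1
    simp only [lastStage]
    omega
  · intro U _ alg δ hδ _ hPAC
    have h := alg.expectedTau_oneBadLeaf_ge hsurj (s₀, a₀) hε hδ hPAC (by
      rw [Fintype.card_fin, Fintype.card_fin]
      nlinarith)
    simpa only [Fintype.card_fin] using h
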